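/- **Corollary (Hashing modulo a random prime / CRT codes).** All logarithms are to base 2. Let $p_1<p_2<\cdots$ be the primes. For integers $k,s\ge 1$ and a real $0<\varepsilon\le 1$ put $n=\lfloor k/\varepsilon^2\rfloor$, and consider the following protocol $\Pi_{k,s,\varepsilon}$ between a verifier $U$ and $s$ provers. The data are $x=(x_1,\dots,x_s)$ with $x_i\in\{0,1,\dots,\prod_{j=1}^k p_j-1\}$, and prover $i$ receives $x_i$. $U$ draws a uniformly random $\beta\in\{1,\dots,n\}$ and stores $\beta$ and the Karp–Rabin fingerprints $x_i \bmod p_\beta$, i.e. the $\beta$-th symbols of the codewords of the $x_i$ in the CRT code $v\mapsto(v\bmod p_1,\dots,v\bmod p_n)$. Later $U$ sends $\beta$ to every prover, receives replies $a_i\in\{0,\dots,p_n-1\}$, and outputs $1$ if $a_i=x_i\bmod p_\beta$ for all $i$, and $0$ otherwise. Fix a reference universal machine, i.e. an additively optimal partial computable decompressor of binary strings, let $C$ be plain Kolmogorov complexity with respect to it, and fix a bound $a$ on the length in bits of the programs with which cheating provers answer challenges, and a real $B>4$. There are positive integers $c_0,c_1,c_2$, depending only on the reference machine, $a$ and $B$,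 such that for all $k,s\ge1$ and $0<\varepsilon\le 1$ with $k/\varepsilon\ge B$ the protocol $\Pi_{k,s,\varepsilon}$ is an $(s,s)$-party verification protocol with the following parameters (an element of a set of size $M$ counting as $\log M$ bits). * *Completeness.* If all provers follow the protocol, $U$ outputs $1$. * *Resource bound.* $U$ stores at most $$(s+1)\log k+s-(s+1)\log\varepsilon^2+s\log\log(k/\varepsilon^2)$$ bits. The number of bits exchanged between $U$ and the provers is at most $$2s\log k-2s\log\varepsilon^2+s+s\log\log(k/\varepsilon^2),$$ of which at most $s\log k-s\log\varepsilon^2+s+s\log\log(k/\varepsilon^2)$ are sent by the provers. * *Verification guarantee $(\varepsilon,f)$*, where $$f(z)=C(z)-c_0\,s\bigl(\log(k/\varepsilon)-\log\log(k/\varepsilon)-1\bigr)-c_1\log\log\log(k/\varepsilon)-c_2 .$$ That is: let $x$ be any data, $T\subseteq\{1,\dots,s\}$ any set of colluding provers, and $y_i$ ($i\in T$) arbitrary binary strings that they store. Suppose that every prover outside $T$ follows the protocol, and that every prover $i\in T$ answers with a program of at most $a$ bits, which may depend on everything (including $x$ but not the challenge), is run on $i$ and on all the indices, challenges and stored strings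 of the provers in $T$, and terminates with an element of $\{0,\dots,p_n-1\}$ on every challenge. If $U$ outputs $1$ with probability at least $\varepsilon$, then $\sum_{i\in T}|y_i|\ge f(x_T)$, where $x_T$ is the concatenation of the $x_i$, $i\in T$, written in binary with the common width of the numbers below $\prod_{j\le k}p_j$. *Efficiency.* There are programs for a logarithmic-cost random access machine and a polynomial $P$, all independent of $k,s,\varepsilon$, such that for all $k,s\ge1$ and $0<\varepsilon\le1$ the programs carry out the work of the honest parties in $\Pi_{k,s,\varepsilon}$; each honest prover's reply takes time at most $P(n)$, and each of the verifier's tasks (preprocessing, sending the challenges, deciding) takes time at most $P(n+s)$; so all honest parties run in time polynomial in $n$ when, as usual, $s\le k$. -/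

import Mathlib

/-! ### Plain Kolmogorov complexity -/

/-- `U` is a reference universal machine for plain Kolmogorov complexity: a partial computable
decompressor of binary strings that is additively optimal among all partial computable ones. -/
structure IsOptimalMachine (U : List Bool →. List Bool) : Prop where
  partrec : Partrec U
  optimal : ∀ D : List Bool →. List Bool, Partrec D →
    ∃ c : ℕ, ∀ p x, x ∈ D p → ∃ p', x ∈ U p' ∧ p'.length ≤ p.length + c

/-- Plain Kolmogorov complexity `C(x)` of a binary string with respect to the machine `U`
(for an optimal `U` every string has a description, so the infimum is a minimum). -/
noncomputable def plainComplexity (U : List Bool →. List Bool) (x : List Bool) : ℕ :=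
  sInf {l | ∃ p : List Bool, x ∈ U p ∧ p.length = l}

/-- The length in bits of (the Gödel number of) a program. -/
def programLength (c : Nat.Partrec.Code) : ℕ :=
  Nat.size (Encodable.encode c)

/-! ### Random access machines with logarithmic cost -/

/-- Structured programs for a random access machine: registers hold natural numbers, and there is
a separate memory, an array of natural numbers that is addressed through registers. -/
inductive Ram : Type
  | const (r v : ℕ) : Ram
  | add (r a b : ℕ) : Ram
  | sub (r a b : ℕ) : Ram
  | mul (r a b : ℕ) : Ram
  | div (r a b : ℕ) : Ram
  | load (r a : ℕ) : Ram
  | store (a b : ℕ) : Ram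
  | seq (c d : Ram) : Ram
  | cond (r : ℕ) (c d : Ram) : Ram
  | loop (r : ℕ) (c : Ram) : Ram

namespace Ram

/-- The contents of the registers and of the memory. -/
structure Config where
  reg : ℕ → ℕ
  mem : ℕ → ℕ

/-- `S.setReg r v` writes `v` into register `r`. -/
def Config.setReg (S : Config) (r v : ℕ) : Config :=
  { S with reg := Function.update S.reg r v }

/-- `S.setMem i v` writes `v` into the memory cell with address `i`. -/
def Config.setMem (S : Config) (i v : ℕ) : Config :=
  { S with mem := Function.update S.mem i v }

/-- The logarithmic cost of a number: its binary length plus one. -/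
def lg (v : ℕ) : ℕ := Nat.size v + 1

/-- `Exec c S S' t`: the program `c`, started in `S`, halts in `S'` after time `t`, where every
elementary instruction costs the total binary length of the numbers and addresses it handles.
Subtraction is truncated and division is integer division. -/
inductive Exec : Ram → Config → Config → ℕ → Prop
  | const (S : Config) (r v : ℕ) : Exec (.const r v) S (S.setReg r v) (lg v)
  | add (S : Config) (r a b : ℕ) :
      Exec (.add r a b) S (S.setReg r (S.reg a + S.reg b)) (lg (S.reg a) + lg (S.reg b))
  | sub (S : Config) (r a b : ℕ) :
      Exec (.sub r a b) S (S.setReg r (S.reg a - S.reg b)) (lg (S.reg a) + lg (S.reg b))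
  | mul (S : Config) (r a b : ℕ) :
      Exec (.mul r a b) S (S.setReg r (S.reg a * S.reg b)) (lg (S.reg a) + lg (S.reg b))
  | div (S : Config) (r a b : ℕ) :
      Exec (.div r a b) S (S.setReg r (S.reg a / S.reg b)) (lg (S.reg a) + lg (S.reg b))
  | load (S : Config) (r a : ℕ) :
      Exec (.load r a) S (S.setReg r (S.mem (S.reg a))) (lg (S.reg a) + lg (S.mem (S.reg a)))
  | store (S : Config) (a b : ℕ) :
      Exec (.store a b) S (S.setMem (S.reg a) (S.reg b)) (lg (S.reg a) + lg (S.reg b))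
  | seq {c d : Ram} {S S' S'' : Config} {t t' : ℕ} (h : Exec c S S' t) (h' : Exec d S' S'' t') :
      Exec (.seq c d) S S'' (t + t')
  | cond_nonzero {r : ℕ} {c d : Ram} {S S' : Config} {t : ℕ} (hr : S.reg r ≠ 0)
      (h : Exec c S S' t) : Exec (.cond r c d) S S' (lg (S.reg r) + t)
  | cond_zero {r : ℕ} {c d : Ram} {S S' : Config} {t : ℕ} (hr : S.reg r = 0)
      (h : Exec d S S' t) : Exec (.cond r c d) S S' (lg (S.reg r) + t)
  | loop_step {r : ℕ} {c : Ram} {S S' S'' : Config} {t t' : ℕ} (hr : S.reg r ≠ 0)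
      (h : Exec c S S' t) (h' : Exec (.loop r c) S' S'' t') :
      Exec (.loop r c) S S'' (lg (S.reg r) + t + t')
  | loop_done {r : ℕ} {c : Ram} {S : Config} (hr : S.reg r = 0) :
      Exec (.loop r c) S S (lg (S.reg r))

/-- The initial configuration on the input `l`: the length of `l` is in cell `0`, its entries are
in the cells `1, 2, …`, and everything else is zero. -/
def init (l : List ℕ) : Config where
  reg := fun _ => 0
  mem := fun i => if i = 0 then l.length else l.getD (i - 1) 0

/-- The output, in the same format. -/
def output (S : Config) : List ℕ :=
  List.ofFn fun i : Fin (S.mem 0) => S.mem (i + 1)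

/-- On the input `inp` the program halts with output `out`, in time at most `t`. -/
def Computes (c : Ram) (inp out : List ℕ) (t : ℕ) : Prop :=
  ∃ S τ, Exec c (init inp) S τ ∧ output S = out ∧ τ ≤ t

end Ram

/-! ### Verification protocols -/

/-- A verification protocol for a verifier and `s` provers. The data `x = (x₁, …, x_s)` consists of
`s` chunks, integers in `{0, …, N - 1}`, and prover `i` is given `x i`. The verifier draws uniform
coins, and stores a state that is computed from the coins and the data (after which the data are
gone). Later she sends each prover a challenge, obtains a reply from each of them, and accepts or
rejects. -/
structure Protocol (s N : ℕ) where
  /-- the number of values of the coins -/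
  coins : ℕ
  /-- the possible contents of the verifier's storage -/
  State : Type
  [fintypeState : Fintype State]
  /-- how the verifier's storage is written as a sequence of numbers -/
  code : State → List ℕ
  /-- the number of possible challenges to a prover -/
  challenges : ℕ
  /-- the number of possible replies of a prover -/
  replies : ℕ
  /-- preprocessing by the verifier -/
  store : Fin coins → (Fin s → Fin N) → State
  /-- the challenges sent to the provers -/
  challenge : State → Fin s → Fin challenges
  /-- the reply of a prover who follows the protocol and stores its chunk -/
  honest : Fin s → Fin challenges → Fin N → Fin replies
  /-- the decision of the verifier -/
  accept : State → (Fin s → Fin replies) → Bool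

attribute [instance] Protocol.fintypeState

/-- The binary expansion of `v < N`, with the common width of all the numbers below `N`. -/
def fixedWidthBits (N v : ℕ) : List Bool :=
  (List.range (Nat.size (N - 1))).map fun j => v.testBit j

/-- The string `x_T`: the concatenation of the chunks with index in `T`. -/
def chunkString {s N : ℕ} (x : Fin s → Fin N) (T : Finset (Fin s)) : List Bool :=
  ((T.sort (· ≤ ·)).map fun i => fixedWidthBits N (x i)).flatten

namespace Protocol

variable {s N : ℕ} (P : Protocol s N)

/-- The number of bits the verifier stores, where an element of a set with `M` elements counts
for `log₂ M` bits. -/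
noncomputable def storageBits : ℝ := Real.logb 2 (Fintype.card P.State)

/-- The number of bits the provers send to the verifier. -/
noncomputable def replyBits : ℝ := s * Real.logb 2 P.replies

/-- The number of bits exchanged between the verifier and the provers: a challenge to and a reply
from each of them. -/
noncomputable def communicationBits : ℝ := s * Real.logb 2 P.challenges + P.replyBits

/-- What the colluding provers in `T`, who have stored the strings `y`, know jointly when they have
received their challenges: the list of all `(j, challenge to j, y_j)`, for `j ∈ T`. -/
def coalitionView (T : Finset (Fin s)) (y : Fin s → List Bool) (σ : P.State) :
    List (ℕ × ℕ × List Bool) :=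
  (T.sort (· ≤ ·)).map fun j : Fin s => ((j : ℕ), (P.challenge σ j : ℕ), y j)

/-- `reply ω` are the replies that the verifier receives when her coins are `ω`, for every `ω`:
the provers outside `T` follow the protocol, and a prover `i ∈ T` runs the program `A i`, which
must terminate, on its index and the joint view of the coalition. -/
def IsPlay (x : Fin s → Fin N) (T : Finset (Fin s)) (y : Fin s → List Bool)
    (A : Fin s → Nat.Partrec.Code) (reply : Fin P.coins → Fin s → Fin P.replies) : Prop :=
  ∀ ω,
    (∀ i ∉ T, reply ω i = P.honest i (P.challenge (P.store ω x) i) (x i)) ∧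
    (∀ i ∈ T, (reply ω i : ℕ) ∈
      (A i).eval (Encodable.encode ((i : ℕ), P.coalitionView T y (P.store ω x))))

/-- The probability, over the coins, that the verifier accepts. -/
noncomputable def acceptProb (x : Fin s → Fin N)
    (reply : Fin P.coins → Fin s → Fin P.replies) : ℝ :=
  (Finset.univ.filter fun ω => P.accept (P.store ω x) (reply ω) = true).card / P.coins

/-- `P` is an `(s, r)`-party verification protocol with resource bound `(storage, communication)`
and verification guarantee `(ρ, f)`, against provers whose programs have at most `a` bits. -/
structure IsVerificationProtocol (r : ℕ) (storage communication : ℝ) (a : ℕ) (ρ : ℝ)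
    (f : List Bool → ℝ) : Prop where
  /-- if all the provers follow the protocol, then the verifier accepts -/
  complete : ∀ ω x,
    P.accept (P.store ω x) (fun i => P.honest i (P.challenge (P.store ω x) i) (x i)) = true
  storage_le : P.storageBits ≤ storage
  communication_le : P.communicationBits ≤ communication
  sound : ∀ (x : Fin s → Fin N) (T : Finset (Fin s)) (y : Fin s → List Bool)
    (A : Fin s → Nat.Partrec.Code) (reply : Fin P.coins → Fin s → Fin P.replies),
    T.card ≤ r → (∀ i ∈ T, programLength (A i) ≤ a) → P.IsPlay x T y A reply →
    ρ ≤ P.acceptProb x reply →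
    f (chunkString x T) ≤ ((∑ i ∈ T, (y i).length : ℕ) : ℝ)

/-- Programs for the honest parties: the three tasks of the verifier and the task of a prover. -/
structure HonestPrograms where
  store : Ram
  challenge : Ram
  accept : Ram
  reply : Ram

/-- The given programs carry out the work of the honest parties in `P`; each task of the verifier
takes time at most `tV`, and the work of a prover takes time at most `tP`. -/
def RunsWithin (h : HonestPrograms) (tV tP : ℕ) : Prop :=
  (∀ (ω : Fin P.coins) (x : Fin s → Fin N),
    h.store.Computes ((ω : ℕ) :: List.ofFn fun i => (x i : ℕ)) (P.code (P.store ω x)) tV) ∧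
  (∀ σ : P.State,
    h.challenge.Computes (P.code σ) (List.ofFn fun i => (P.challenge σ i : ℕ)) tV) ∧
  (∀ (σ : P.State) (z : Fin s → Fin P.replies),
    h.accept.Computes (P.code σ ++ List.ofFn fun i => (z i : ℕ))
      [if P.accept σ z = true then 1 else 0] tV) ∧
  (∀ (i : Fin s) (β : Fin P.challenges) (v : Fin N),
    h.reply.Computes [(i : ℕ), (β : ℕ), (v : ℕ)] [(P.honest i β v : ℕ)] tP)

end Protocol

/-! ### Hashing modulo a random prime -/

/-- `primeAt i` is the `(i + 1)`-st prime: `primeAt 0 = 2`, `primeAt 1 = 3`, … -/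
noncomputable def primeAt (i : ℕ) : ℕ := Nat.nth Nat.Prime i

/-- The number `p₁ p₂ ⋯ p_k` of messages of the CRT code of dimension `k`. -/
noncomputable def crtSize (k : ℕ) : ℕ := ∏ i ∈ Finset.range k, primeAt i

theorem crtSymbol_lt {n : ℕ} (β : Fin n) (v : ℕ) : v % primeAt β < primeAt (n - 1) := by
  have hβ := β.isLt
  exact lt_of_lt_of_le (Nat.mod_lt _ (Nat.prime_nth_prime _).pos)
    (Nat.nth_monotone Nat.infinite_setOfPred_prime (by omega))

/-- The CRT code of block length `n`: the message `v` is mapped to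
`(v mod p₁, …, v mod p_n)`. All symbols are regarded as elements of `{0, …, p_n - 1}`. -/
noncomputable def crtCode (n v : ℕ) (β : Fin n) : Fin (primeAt (n - 1)) :=
  ⟨v % primeAt β, crtSymbol_lt β v⟩

/-- The protocol based on the CRT code with dimension `k` and block length `n`. The verifier draws a
random `β`, stores `β` and the Karp–Rabin fingerprints `x_i mod p_β`, sends `β` to every prover, and
accepts if every prover `i` answers with `x_i mod p_β`. -/
noncomputable def crtProtocol (k n s : ℕ) : Protocol s (crtSize k) where
  coins := n
  State := Fin n × (Fin s → Fin (primeAt (n - 1)))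
  code := fun σ => (σ.1 : ℕ) :: List.ofFn fun i => (σ.2 i : ℕ)
  challenges := n
  replies := primeAt (n - 1)
  store := fun β x => (β, fun i => crtCode n (x i) β)
  challenge := fun σ _ => σ.1
  honest := fun _ β v => crtCode n v β
  accept := fun σ z => decide (z = σ.2)

/-! ### Primes -/

/-! The verification guarantee combines list decoding with a short description of the coalition's
data. If the verifier accepts with probability at least ε, then the replies of each colluding prover
`i`, read as a word indexed by β, agree with the codeword of `x i` in g ≥ εn positions. Two distinct
messages agree in fewer than k positions, since otherwise their difference would be divisible by k
distinct primes, whose product is at least `crtSize k` (`card_lt_of_mod_primeAt_eq`). As n = ⌊k/ε²⌋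
forces n(k - 1) < g² (`lt_sq_of_accept`), the Johnson bound (`card_le_sq_of_pairwise_inter`) leaves
at most n² candidates for `x i`.

Hence x_T can be recomputed from n, k, g and, for each member of T, its program, its stored string
and the position of `x i` in the list of candidates (`exists_reconstruct_of_isPlay`). In a
self-delimiting code this takes ∑|y_i| + O(s log n) bits, with constants depending on a, and
additive optimality turns the code length into a bound on C(x_T)
(`IsOptimalMachine.exists_plainComplexity_le`). With l = log(k/ε) one has log n ≤ 2l, and l - log l
- 1 ≥ δl for some δ > 0 as soon as l ≥ log B > 2 (`exists_mul_le_sub_logb`), so the c₀ term absorbs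
the overhead.

The resource bound is the estimate p_n ≤ 2n log n for n ≥ 4 (`primeAt_le_two_mul_logb`), deduced
from Chebyshev's lower bound for π and a small table. Efficiency is shown by explicit programs:
trial division finds p_β, each fingerprint is one division with remainder, and all numbers involved
have O((n + s)²) bits. -/

theorem primeAt_prime (i : ℕ) : (primeAt i).Prime := Nat.prime_nth_prime i

theorem primeAt_strictMono : StrictMono primeAt :=
  Nat.nth_strictMono Nat.infinite_setOfPred_prime

theorem primeAt_count {q : ℕ} (hq : q.Prime) : primeAt (Nat.count Nat.Prime q) = q :=
  Nat.nth_count hq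

theorem primeAt_zero : primeAt 0 = 2 := Nat.nth_prime_zero_eq_two

theorem two_pow_le_iff_logb {x y : ℝ} (hx : 0 < x) (h : (2 : ℝ) ^ y ≤ x) : y ≤ Real.logb 2 x :=
  (Real.le_logb_iff_rpow_le (by norm_num) hx).2 h

/-- The tangent line of the binary logarithm, with a rational slope. -/
theorem logb_two_le_tangent {x q : ℝ} (hx : 0 < x) (hq : 0 < q) (hqx : q ≤ x) :
    Real.logb 2 x ≤ Real.logb 2 q + 3 / 2 * (x / q - 1) := by
  -- The true slope at `q` is 1/(q log 2); the inequality log 2 > 2/3 permits the factor 3/2.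
  have h2 : (2 / 3 : ℝ) < Real.log 2 := by linarith [Real.log_two_gt_d9]
  have h1 : Real.log (x / q) ≤ x / q - 1 := Real.log_le_sub_one_of_pos (by positivity)
  have h3 : 0 ≤ x / q - 1 := by
    rw [sub_nonneg, one_le_div hq]; exact hqx
  have h4 : Real.logb 2 x = Real.logb 2 q + Real.log (x / q) / Real.log 2 := by
    rw [Real.log_div hx.ne' hq.ne', Real.logb, Real.logb]; ring
  rw [h4]
  gcongr
  rw [div_le_iff₀ (by linarith)]
  nlinarith

/-- Chebyshev's lower bound for π, evaluated at the prime itself, where π takes the value n + 1. -/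
theorem le_mul_logb_of_primeAt (n : ℕ) :
    (primeAt n : ℝ) ≤
      (n + 1) * Real.logb 2 (primeAt n) + Real.logb 2 (primeAt n + 1) := by
  have h := Chebyshev.pi_ge (primeAt n)
  have hπ : Nat.primeCounting (primeAt n) = n + 1 := by
    rw [Nat.primeCounting, Nat.primeCounting', Nat.count_succ, primeAt, Nat.count_nth_of_infinite
      Nat.infinite_setOfPred_prime, if_pos (Nat.prime_nth_prime n)]
  have hp : (2 : ℝ) ≤ primeAt n := by exact_mod_cast (primeAt_prime n).two_le
  rw [hπ, div_le_iff₀ (Real.log_pos (by linarith))] at h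
  have h2 : 0 < Real.log 2 := Real.log_pos (by norm_num)
  rw [Real.logb, Real.logb]
  have : (primeAt n : ℝ) * Real.log 2 ≤
      (n + 1) * Real.log (primeAt n) + Real.log (primeAt n + 1) := by
    push_cast at h; linarith
  calc (primeAt n : ℝ) = (primeAt n * Real.log 2) / Real.log 2 := by field_simp
    _ ≤ ((n + 1) * Real.log (primeAt n) + Real.log (primeAt n + 1)) / Real.log 2 := by gcongr
    _ = _ := by ring

/-- With x = n and l = log x, suppose p exceeds q = 2xl. Replacing log p by the tangent at q costs
at most (p - q)/2 on the right of Chebyshev's inequality, which leaves q ≤ (x + 1) log q + 1. The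
tangent of log l at l = 4 bounds log q by 3/2 + 11l/8. This is contradictory from x = 16, l = 4 on,
where it would say 128 ≤ 120. -/
theorem primeAt_le_of_large {n : ℕ} (hn : 16 ≤ n) :
    (primeAt (n - 1) : ℝ) ≤ 2 * n * Real.logb 2 n := by
  obtain ⟨m, rfl⟩ : ∃ m, n = m + 1 := ⟨n - 1, by omega⟩
  have h := le_mul_logb_of_primeAt m
  rw [Nat.add_sub_cancel]
  have hnR : (16 : ℝ) ≤ (m + 1 : ℕ) := by exact_mod_cast hn
  have hcast : ((m + 1 : ℕ) : ℝ) = (m : ℝ) + 1 := by push_cast; ring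
  rw [← hcast] at h
  generalize ((m + 1 : ℕ) : ℝ) = x at h hnR ⊢
  have hp : (2 : ℝ) ≤ (primeAt m : ℝ) := by exact_mod_cast (primeAt_prime m).two_le
  generalize (primeAt m : ℝ) = p at h hp ⊢
  set l := Real.logb 2 x with hl
  have hL : 4 ≤ l := two_pow_le_iff_logb (by linarith) (by norm_num; linarith)
  by_contra! hlt
  set q := 2 * x * l with hq
  have hq128 : 128 ≤ q := by rw [hq]; nlinarith
  have hlogq : Real.logb 2 q = 1 + l + Real.logb 2 l := by
    rw [hq, Real.logb_mul (by positivity) (by positivity), Real.logb_mul (by norm_num)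
      (by positivity), Real.logb_self_eq_one (by norm_num)]
  have hlogl : Real.logb 2 l ≤ 2 + 3 / 2 * (l / 4 - 1) := by
    have := logb_two_le_tangent (x := l) (q := 4) (by linarith) (by norm_num) hL
    rwa [show Real.logb 2 4 = 2 by
      rw [show (4 : ℝ) = 2 ^ (2 : ℝ) by norm_num, Real.logb_rpow (by norm_num) (by norm_num)]]
      at this
  have hlogp := logb_two_le_tangent (x := p) (q := q) (by linarith) (by linarith) hlt.le
  have hlogp1 : Real.logb 2 (p + 1) ≤ 1 + Real.logb 2 p := by
    have : Real.logb 2 (p + 1) ≤ Real.logb 2 (2 * p) :=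
      Real.logb_le_logb_of_le (by norm_num) (by linarith) (by linarith)
    rwa [Real.logb_mul (by norm_num) (by linarith), Real.logb_self_eq_one (by norm_num)] at this
  have hd : p / q - 1 = (p - q) / q := by field_simp
  have hslope : (x + 1) * (3 / 2 * (p / q - 1)) ≤ (p - q) / 2 := by
    rw [hd, show (x + 1) * (3 / 2 * ((p - q) / q)) = ((x + 1) * 3 / q) * ((p - q) / 2) by ring]
    have : (x + 1) * 3 / q ≤ 1 := by
      rw [div_le_one (by linarith), hq]; nlinarith
    nlinarith
  have hmain : q ≤ (x + 1) * Real.logb 2 q + 1 := by nlinarith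
  rw [hlogq] at hmain
  have : (x + 1) * (1 + l + Real.logb 2 l) ≤ (x + 1) * (3 / 2 + 11 / 8 * l) :=
    mul_le_mul_of_nonneg_left (by linarith) (by linarith)
  nlinarith

theorem primeAt_le_of_le {i q : ℕ} (hq : q.Prime) (hi : i ≤ Nat.count Nat.Prime q) :
    primeAt i ≤ q :=
  (primeAt_strictMono.monotone hi).trans_eq (primeAt_count hq)

/-- An explicit Chebyshev bound for the `n`-th prime. -/
theorem primeAt_le_two_mul_logb {n : ℕ} (hn : 4 ≤ n) :
    (primeAt (n - 1) : ℝ) ≤ 2 * n * Real.logb 2 n := by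
  -- One entry of the table treats a block of values of n: `q` is at least the n-th prime, `n₀` is a
  -- lower bound for n, and `b` is a lower bound for log n₀.
  have key : ∀ (q n₀ : ℕ) (b : ℝ), q.Prime → n - 1 ≤ Nat.count Nat.Prime q → 0 ≤ b → 1 ≤ n₀ →
      n₀ ≤ n → (2 : ℝ) ^ b ≤ n₀ → (q : ℝ) ≤ 2 * n₀ * b →
      (primeAt (n - 1) : ℝ) ≤ 2 * n * Real.logb 2 n := by
    intro q n₀ b hq hc hb0 hn₀ hn hb hle
    have h1 : (primeAt (n - 1) : ℝ) ≤ q := by exact_mod_cast primeAt_le_of_le hq hc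
    have h2 : (n₀ : ℝ) ≤ n := by exact_mod_cast hn
    have h0 : (1 : ℝ) ≤ n₀ := by exact_mod_cast hn₀
    have h3 : b ≤ Real.logb 2 n := two_pow_le_iff_logb (by linarith) (hb.trans h2)
    have : 2 * (n₀ : ℝ) * b ≤ 2 * n * Real.logb 2 n := by gcongr
    linarith
  rcases le_or_gt 16 n with h | h
  · exact primeAt_le_of_large h
  have c11 : Nat.count Nat.Prime 11 = 4 := by decide
  have c19 : Nat.count Nat.Prime 19 = 7 := by decide
  have c31 : Nat.count Nat.Prime 31 = 10 := by decide
  have c47 : Nat.count Nat.Prime 47 = 14 := by decide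
  rcases le_or_gt n 5 with h5 | h5
  · exact key 11 4 2 (by norm_num) (by omega) (by norm_num) (by norm_num) hn (by norm_num)
      (by norm_num)
  rcases le_or_gt n 8 with h8 | h8
  · exact key 19 6 2 (by norm_num) (by omega) (by norm_num) (by norm_num) (by omega) (by norm_num)
      (by norm_num)
  rcases le_or_gt n 11 with h11 | h11
  · exact key 31 8 3 (by norm_num) (by omega) (by norm_num) (by norm_num) (by omega) (by norm_num)
      (by norm_num)
  · exact key 47 12 3 (by norm_num) (by omega) (by norm_num) (by norm_num) (by omega) (by norm_num)
      (by norm_num)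

/-- A crude polynomial bound for all primes. -/
theorem primeAt_le_sq (i : ℕ) : primeAt i ≤ 2 * (i + 1) ^ 2 := by
  rcases le_or_gt 4 (i + 1) with h | h
  · have h1 := primeAt_le_two_mul_logb h
    rw [Nat.add_sub_cancel] at h1
    have h2 : Real.logb 2 ((i + 1 : ℕ) : ℝ) ≤ (i + 1 : ℕ) := by
      rw [Real.logb_le_iff_le_rpow (by norm_num) (by positivity), Real.rpow_natCast]
      exact_mod_cast (Nat.lt_two_pow_self).le
    have : (primeAt i : ℝ) ≤ 2 * (i + 1 : ℕ) * (i + 1 : ℕ) := h1.trans (by gcongr)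
    have : primeAt i ≤ 2 * (i + 1) * (i + 1) := by exact_mod_cast this
    linarith [sq (i + 1)]
  · have c5 : Nat.count Nat.Prime 5 = 2 := by decide
    have c3 : Nat.count Nat.Prime 3 = 1 := by decide
    have hi : i < 3 := by omega
    interval_cases i
    · rw [primeAt_zero]; norm_num
    · exact (primeAt_le_of_le Nat.prime_three (by omega)).trans (by norm_num)
    · exact (primeAt_le_of_le Nat.prime_five (by omega)).trans (by norm_num)

/-! ### List decoding of the CRT code -/

/-- The Johnson bound: a family of subsets of `{0, …, n - 1}` with at least `t` elements each, any
two of which have at most `d` common elements, has at most `n ^ 2` members when `n * d < t ^ 2`. -/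
theorem card_le_sq_of_pairwise_inter {V : Type*} [DecidableEq V] {n t d : ℕ} (F : Finset V)
    (A : V → Finset ℕ) (hA : ∀ v ∈ F, A v ⊆ Finset.range n) (ht : ∀ v ∈ F, t ≤ (A v).card)
    (hd : ∀ v ∈ F, ∀ w ∈ F, v ≠ w → (A v ∩ A w).card ≤ d) (htd : n * d < t ^ 2) :
    F.card ≤ n ^ 2 := by
  set S := ∑ v ∈ F, (A v).card with hS
  have hcard : ∀ v ∈ F, ∀ B : Finset ℕ, B ⊆ A v →
      B.card = ∑ β ∈ Finset.range n, if β ∈ B then 1 else 0 := by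
    intro v hv B hB
    rw [Finset.sum_ite_mem, Finset.inter_eq_right.2 (hB.trans (hA v hv)), Finset.card_eq_sum_ones]
  have hS1 : S = ∑ β ∈ Finset.range n, ∑ v ∈ F, if β ∈ A v then 1 else 0 := by
    rw [Finset.sum_comm, hS]
    exact Finset.sum_congr rfl fun v hv => hcard v hv _ subset_rfl
  -- The second moment of the number of sets through a point counts pairs of sets with a common
  -- point; Cauchy–Schwarz compares it with the first moment S.
  have hS2 : ∑ β ∈ Finset.range n, (∑ v ∈ F, if β ∈ A v then 1 else 0) ^ 2 =
      ∑ v ∈ F, ∑ w ∈ F, (A v ∩ A w).card := by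
    simp_rw [sq, Finset.sum_mul_sum]
    rw [Finset.sum_comm]
    refine Finset.sum_congr rfl fun v hv => ?_
    rw [Finset.sum_comm]
    refine Finset.sum_congr rfl fun w _ => ?_
    rw [hcard v hv _ Finset.inter_subset_left]
    refine Finset.sum_congr rfl fun β _ => ?_
    by_cases h1 : β ∈ A v <;> by_cases h2 : β ∈ A w <;> simp [h1, h2]
  have hCS : S ^ 2 ≤ n * ∑ v ∈ F, ∑ w ∈ F, (A v ∩ A w).card := by
    rw [hS1, ← hS2]
    have := sq_sum_le_card_mul_sum_sq (s := Finset.range n)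
      (f := fun β => ∑ v ∈ F, if β ∈ A v then 1 else 0)
    rwa [Finset.card_range] at this
  have hpair : ∑ v ∈ F, ∑ w ∈ F, (A v ∩ A w).card ≤ S + F.card * (F.card * d) := by
    have : ∀ v ∈ F, ∑ w ∈ F, (A v ∩ A w).card ≤ (A v).card + F.card * d := by
      intro v hv
      calc ∑ w ∈ F, (A v ∩ A w).card ≤ ∑ w ∈ F, ((if v = w then (A v).card else 0) + d) := by
            refine Finset.sum_le_sum fun w hw => ?_
            by_cases h : v = w
            · subst h; simp
            · simpa [h] using hd v hv w hw h
        _ = _ := by rw [Finset.sum_add_distrib]; simp [hv]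
    calc _ ≤ ∑ v ∈ F, ((A v).card + F.card * d) := Finset.sum_le_sum this
      _ = _ := by rw [Finset.sum_add_distrib]; simp [hS]
  have hSn : S ≤ F.card * n := by
    simpa using Finset.sum_le_card_nsmul F (fun v => (A v).card) n fun v hv => by
      simpa using Finset.card_le_card (hA v hv)
  have hSt : F.card * t ≤ S := by
    simpa using Finset.card_nsmul_le_sum F (fun v => (A v).card) t ht
  -- After cancelling one factor |F| this is |F|t² ≤ n² + |F|nd, and t² ≥ nd + 1 leaves |F| ≤ n².
  have h1 : (F.card * t) ^ 2 ≤ n * (F.card * n + F.card * (F.card * d)) :=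
    (Nat.pow_le_pow_left hSt 2).trans (hCS.trans (by gcongr; exact hpair.trans (by gcongr)))
  rcases Nat.eq_zero_or_pos F.card with h0 | h0
  · simp [h0]
  · have h2 : F.card * (n * d + 1) ≤ F.card * t ^ 2 := Nat.mul_le_mul_left _ htd
    have h3 : F.card * (F.card * t ^ 2) ≤ F.card * (n ^ 2 + F.card * (n * d)) := by
      calc _ = (F.card * t) ^ 2 := by ring
        _ ≤ _ := h1
        _ = _ := by ring
    have h4 := Nat.le_of_mul_le_mul_left h3 h0
    linarith

/-! ### Distance of the CRT code -/

theorem crtSize_pos (k : ℕ) : 0 < crtSize k :=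
  Finset.prod_pos fun i _ => (primeAt_prime i).pos

/-- The first primes have the smallest product: the maximum of a set is at least the number of its
other elements, so the maximum can be removed inductively. -/
theorem crtSize_card_le_prod (S : Finset ℕ) : crtSize S.card ≤ ∏ β ∈ S, primeAt β := by
  induction S using Finset.induction_on_max with
  | empty => simp [crtSize]
  | insert a s h ih =>
    have ha : a ∉ s := fun h' => lt_irrefl _ (h a h')
    rw [Finset.card_insert_of_notMem ha, Finset.prod_insert ha, crtSize, Finset.prod_range_succ,
      mul_comm]
    refine Nat.mul_le_mul (primeAt_strictMono.monotone ?_) ih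
    simpa using Finset.card_le_card (s := s) (t := Finset.range a)
      fun b hb => Finset.mem_range.2 (h b hb)

theorem crtSize_mono : Monotone crtSize := fun _ _ h =>
  Finset.prod_le_prod_of_subset_of_one_le' (Finset.range_mono h)
    fun _ _ _ => (primeAt_prime _).one_le

/-- The CRT code has large distance. -/
theorem card_lt_of_mod_primeAt_eq {k v w : ℕ} (hv : v < crtSize k) (hw : w < crtSize k)
    (hvw : v ≠ w) (S : Finset ℕ) (hS : ∀ β ∈ S, v % primeAt β = w % primeAt β) : S.card < k := by
  by_contra! hk
  wlog h : v < w generalizing v w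
  · exact this hw hv hvw.symm (fun β hβ => (hS β hβ).symm) (by omega)
  -- The product of these distinct primes is at least `crtSize k`, whereas 0 < w - v < `crtSize k`.
  have hdvd : ∏ β ∈ S, primeAt β ∣ w - v := by
    refine Finset.prod_dvd_of_isRelPrime (fun β _ γ _ h' => Nat.coprime_iff_isRelPrime.1
      ((Nat.coprime_primes (primeAt_prime β) (primeAt_prime γ)).2
        (primeAt_strictMono.injective.ne h'))) fun β hβ => ?_
    exact (Nat.modEq_iff_dvd' h.le).1 (hS β hβ)
  have := Nat.le_of_dvd (by omega) hdvd
  have := crtSize_card_le_prod S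
  have := crtSize_mono hk
  omega

/-- The messages whose codewords agree with the word `r` in at least `t` positions. -/
noncomputable def decodings (n k t : ℕ) (r : ℕ → ℕ) : Finset ℕ :=
  (Finset.range (crtSize k)).filter fun v =>
    t ≤ ((Finset.range n).filter fun β => r β = v % primeAt β).card

theorem card_decodings_le {n k t : ℕ} (hk : 1 ≤ k) (ht : n * (k - 1) < t ^ 2) (r : ℕ → ℕ) :
    (decodings n k t r).card ≤ n ^ 2 := by
  refine card_le_sq_of_pairwise_inter _
    (fun v => (Finset.range n).filter fun β => r β = v % primeAt β) (fun v _ =>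
      Finset.filter_subset _ _) (fun v hv => (Finset.mem_filter.1 hv).2) ?_ ht
  intro v hv w hw hvw
  have h := card_lt_of_mod_primeAt_eq (Finset.mem_range.1 (Finset.mem_filter.1 hv).1)
    (Finset.mem_range.1 (Finset.mem_filter.1 hw).1) hvw
    ((Finset.range n).filter (fun β => r β = v % primeAt β) ∩
      (Finset.range n).filter fun β => r β = w % primeAt β) (by
        intro β hβ
        simp only [Finset.mem_inter, Finset.mem_filter] at hβ
        rw [← hβ.1.2, hβ.2.2])
  omega

/-! ### Primitive recursive functions -/

section Primrec

variable {α β : Type*} [Primcodable α] [Primcodable β]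

theorem Primrec.list_filter_param {f : α → List β} {R : α → β → Prop} [DecidableRel R]
    (hf : Primrec f) (hR : PrimrecRel R) : Primrec fun a => (f a).filter fun b => R a b := by
  simp only [← List.filterMap_eq_filter]
  refine Primrec.listFilterMap hf (Primrec.ite ?_ ?_ (Primrec.const Option.none))
  · exact Primrec.eq.comp hR.decide (.const true)
  · exact Primrec.option_some.comp Primrec.snd

theorem Primrec.nat_dvd : PrimrecRel fun a b : ℕ => a ∣ b :=
  (Primrec.eq.comp (Primrec.nat_mod.comp Primrec.snd Primrec.fst) (Primrec.const 0)).of_eq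
    fun p => (Nat.dvd_iff_mod_eq_zero (m := p.1) (n := p.2)).symm

theorem Primrec.nat_prime : PrimrecPred Nat.Prime := by
  have h1 : PrimrecRel fun m p : ℕ => ¬ m ∣ p ∨ m = 1 :=
    Primrec.nat_dvd.not.or (Primrec.eq.comp Primrec.fst (Primrec.const 1))
  have h2 : PrimrecPred fun p : ℕ => 2 ≤ p ∧ ∀ m < p, ¬ m ∣ p ∨ m = 1 :=
    (Primrec.nat_le.comp (Primrec.const 2) Primrec.id).and
      ((h1.forall_lt).comp Primrec.id Primrec.id)
  refine h2.of_eq fun p => ?_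
  rw [Nat.prime_def_lt]
  simp only [imp_iff_not_or]

theorem Primrec.nat_count_prime : Primrec fun b : ℕ => Nat.count Nat.Prime b :=
  (Primrec.list_length.comp (Primrec.list_filter_param (R := fun _ b => Nat.Prime b)
    Primrec.list_range (Primrec.nat_prime.comp Primrec.snd))).of_eq fun b => by
      rw [Nat.count_eq_card_filter_range]
      rfl

/-- The quadratic bound makes the search bounded. `Nat.count` counts primes strictly below its
argument, so the i-th prime, counted from zero, is the greatest b with at most i primes below it. -/
theorem primeAt_primrec : Primrec primeAt := by
  have h : Primrec fun i : ℕ =>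
      Nat.findGreatest (fun b => Nat.count Nat.Prime b ≤ i) (2 * (i + 1) ^ 2) := by
    refine Primrec.nat_findGreatest (p := fun i b => Nat.count Nat.Prime b ≤ i) ?_
      (Primrec.nat_le.comp (Primrec.nat_count_prime.comp Primrec.snd) Primrec.fst)
    simp only [sq]
    exact Primrec.nat_mul.comp (Primrec.const 2) (Primrec.nat_mul.comp Primrec.succ Primrec.succ)
  refine h.of_eq fun i => ?_
  rw [Nat.findGreatest_eq_iff]
  refine ⟨primeAt_le_sq i, fun _ => (Nat.primeCounting'_nth_eq i).le, fun b hb _ hc => ?_⟩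
  have h1 : Nat.count Nat.Prime (primeAt i + 1) ≤ Nat.count Nat.Prime b := Nat.count_monotone _ hb
  rw [Nat.count_succ, if_pos (primeAt_prime i)] at h1
  have h2 : Nat.count Nat.Prime (primeAt i) = i := Nat.primeCounting'_nth_eq i
  omega

theorem crtSize_primrec : Primrec crtSize := by
  refine (Primrec.nat_rec₁ (f := fun k v => v * primeAt k) 1
    (Primrec.nat_mul.comp Primrec.snd (primeAt_primrec.comp Primrec.fst))).of_eq fun k => ?_
  induction k with
  | zero => simp [crtSize]
  | succ k ih => rw [crtSize, Finset.prod_range_succ, ← crtSize, ← ih]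

theorem Primrec.two_pow : Primrec fun k : ℕ => 2 ^ k := by
  refine (Primrec.nat_rec₁ (f := fun _ v => 2 * v) 1
    (Primrec.nat_mul.comp (Primrec.const 2) Primrec.snd)).of_eq fun k => ?_
  induction k with
  | zero => rfl
  | succ k ih => rw [pow_succ', ← ih]

theorem Primrec.nat_size : Primrec Nat.size := by
  refine (Primrec.nat_findGreatest (f := id) (p := fun n m => 2 ^ (m - 1) ≤ n) Primrec.id
    (Primrec.nat_le.comp (Primrec.two_pow.comp (Primrec.pred.comp Primrec.snd))
      Primrec.fst)).of_eq fun n => ?_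
  rw [Nat.findGreatest_eq_iff]
  refine ⟨Nat.size_le.2 Nat.lt_two_pow_self, fun h => Nat.lt_size.1 (by omega), fun m hm _ => ?_⟩
  rw [← Nat.lt_size]
  omega

theorem Primrec.nat_testBit : Primrec₂ Nat.testBit := by
  have h : PrimrecRel fun v j : ℕ => v / 2 ^ j % 2 = 1 :=
    Primrec.eq.comp (Primrec.nat_mod.comp (Primrec.nat_div.comp Primrec.fst
      (Primrec.two_pow.comp Primrec.snd)) (Primrec.const 2)) (Primrec.const 1)
  exact h.decide.of_eq fun v j => (Nat.testBit_eq_decide_div_mod_eq).symm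

theorem fixedWidthBits_primrec : Primrec₂ fixedWidthBits :=
  Primrec.list_map (Primrec.list_range.comp (Primrec.nat_size.comp
    (Primrec.pred.comp Primrec.fst))) (Primrec.nat_testBit.comp
      (Primrec.snd.comp Primrec.fst) Primrec.snd)

end Primrec

/-! ### Self-delimiting codes -/

/-- `f` is injective, and its values can be recognized as initial segments. -/
def PrefixFree {α : Type*} (f : α → List Bool) : Prop :=
  ∀ a b r r', f a ++ r = f b ++ r' → a = b ∧ r = r'

/-- The self-delimiting code of a number `v`, of length `2 * size v + 1`. -/
def numCode (v : ℕ) : List Bool :=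
  -- The width is exactly `Nat.size v`. Each bit is announced by `true`, and `false` marks the end.
  (fixedWidthBits (v + 1) v).flatMap (fun b => [true, b]) ++ [false]

/-- The self-delimiting code of a bit string. -/
def strCode (y : List Bool) : List Bool := numCode y.length ++ y

/-- The concatenation of two codes. -/
def pairCode {α β : Type*} (f : α → List Bool) (g : β → List Bool) (p : α × β) : List Bool :=
  f p.1 ++ g p.2

/-- A code for `Option α`. -/
def optionCode {α : Type*} (f : α → List Bool) (o : Option α) : List Bool :=
  o.elim [false] fun a => true :: f a

/-- A code for lists. -/
def listCode {α : Type*} (f : α → List Bool) (l : List α) : List Bool :=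
  numCode l.length ++ l.flatMap f

/-- The markers in front of the bits show where the code ends. Equal bit lists give equal binary
lengths, and all higher bits vanish. -/
theorem numCode_prefixFree : PrefixFree numCode := by
  intro v w r r' h
  have key : ∀ l l' : List Bool, l.flatMap (fun b => [true, b]) ++ [false] ++ r =
      l'.flatMap (fun b => [true, b]) ++ [false] ++ r' → l = l' ∧ r = r' := by
    intro l
    induction l with
    | nil =>
      intro l' h
      cases l' with
      | nil => simpa using h
      | cons b l' => simp at h
    | cons a l ih =>
      intro l' h
      cases l' with
      | nil => simp at h
      | cons b l' =>
        simp only [List.flatMap_cons, List.cons_append, List.nil_append, List.append_assoc,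
          List.cons.injEq, true_and] at h ih
        obtain ⟨h1, h2⟩ := ih l' h.2
        exact ⟨by rw [h.1, h1], h2⟩
  obtain ⟨h1, h2⟩ := key _ _ h
  refine ⟨?_, h2⟩
  have hs : Nat.size v = Nat.size w := by
    simpa [fixedWidthBits] using congrArg List.length h1
  refine Nat.eq_of_testBit_eq fun j => ?_
  rcases lt_or_ge j (Nat.size v) with hj | hj
  · have := congrArg (fun l : List Bool => l[j]?) h1
    simpa [fixedWidthBits, hj, hs ▸ hj] using this
  · rw [Nat.testBit_lt_two_pow ((Nat.size_le).1 hj), Nat.testBit_lt_two_pow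
      ((Nat.size_le).1 (hs ▸ hj))]

theorem PrefixFree.pair {α β : Type*} {f : α → List Bool} {g : β → List Bool}
    (hf : PrefixFree f) (hg : PrefixFree g) : PrefixFree (pairCode f g) := by
  rintro ⟨a, b⟩ ⟨a', b'⟩ r r' h
  simp only [pairCode, List.append_assoc] at h
  obtain ⟨rfl, h₁⟩ := hf _ _ _ _ h
  obtain ⟨rfl, h₂⟩ := hg _ _ _ _ h₁
  exact ⟨rfl, h₂⟩

theorem PrefixFree.option {α : Type*} {f : α → List Bool} (hf : PrefixFree f) :
    PrefixFree (optionCode f) := by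
  rintro (_ | a) (_ | b) r r' h
  · simpa [optionCode] using h
  · simp [optionCode] at h
  · simp [optionCode] at h
  · obtain ⟨rfl, h₁⟩ := hf a b r r' (by simpa [optionCode] using h)
    exact ⟨rfl, h₁⟩

/-- The length in front says how many codes are to be read. -/
theorem PrefixFree.list {α : Type*} {f : α → List Bool} (hf : PrefixFree f) :
    PrefixFree (listCode f) := by
  intro l l' r r' h
  simp only [listCode, List.append_assoc] at h
  obtain ⟨hl, h₁⟩ := numCode_prefixFree _ _ _ _ h
  clear h
  induction l generalizing l' with
  | nil =>
    obtain rfl := List.length_eq_zero_iff.1 hl.symm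
    simpa using h₁
  | cons a l ih =>
    cases l' with
    | nil => simp at hl
    | cons b l' =>
      simp only [List.flatMap_cons, List.append_assoc] at h₁
      obtain ⟨rfl, h₂⟩ := hf _ _ _ _ h₁
      obtain ⟨rfl, h₃⟩ := ih l' (by simpa using hl) h₂
      exact ⟨rfl, h₃⟩

theorem strCode_prefixFree : PrefixFree strCode := by
  intro y z r r' h
  simp only [strCode, List.append_assoc] at h
  obtain ⟨hl, h⟩ := numCode_prefixFree _ _ _ _ h
  exact List.append_inj h hl

theorem numCode_length (v : ℕ) : (numCode v).length = 2 * Nat.size v + 1 := by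
  simp [numCode, fixedWidthBits, mul_comm, Function.comp_def]

theorem strCode_length (y : List Bool) :
    (strCode y).length = 2 * Nat.size y.length + 1 + y.length := by
  simp [strCode, numCode_length]

theorem numCode_primrec : Primrec numCode := by
  refine Primrec.list_append.comp (Primrec.list_flatMap (fixedWidthBits_primrec.comp
    Primrec.succ Primrec.id) ?_) (Primrec.const [false])
  exact Primrec.list_cons.comp (Primrec.const true)
    (Primrec.list_cons.comp Primrec.snd (Primrec.const []))

theorem strCode_primrec : Primrec strCode :=
  Primrec.list_append.comp (numCode_primrec.comp Primrec.list_length) Primrec.id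

section Primrec

variable {α β : Type*} [Primcodable α] [Primcodable β] {f : α → List Bool} {g : β → List Bool}

theorem pairCode_primrec (hf : Primrec f) (hg : Primrec g) : Primrec (pairCode f g) :=
  Primrec.list_append.comp (hf.comp Primrec.fst) (hg.comp Primrec.snd)

theorem optionCode_primrec (hf : Primrec f) : Primrec (optionCode f) :=
  (Primrec.option_casesOn Primrec.id (Primrec.const [false]) (Primrec.list_cons.comp
    (Primrec.const true) (hf.comp Primrec.snd)).to₂).of_eq fun o => by cases o <;> rfl

theorem listCode_primrec (hf : Primrec f) : Primrec (listCode f) :=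
  Primrec.list_append.comp (numCode_primrec.comp Primrec.list_length)
    (Primrec.list_flatMap Primrec.id (hf.comp Primrec.snd).to₂)

end Primrec

/-! ### Reconstructing the data of a coalition -/

section Reconstruct

open Nat.Partrec (Code)

/-- The entries present in a list of optional entries, together with their positions. -/
def members {α : Type*} (es : List (Option α)) : List (ℕ × α) :=
  (List.range es.length).filterMap fun i => es[i]?.join.map (Prod.mk i)

/-- The joint view of a coalition whose members have an index, a program, a further number, and a
stored string. -/
def jointView (l : List (ℕ × ℕ × ℕ × List Bool)) (β : ℕ) : List (ℕ × ℕ × List Bool) :=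
  l.map fun e => (e.1, β, e.2.2.2)

/-- The reply of a member of a coalition to the challenge `β`, if it is found within the given
number of steps. -/
def boundedReply (l : List (ℕ × ℕ × ℕ × List Bool)) (fuel : ℕ) (e : ℕ × ℕ × ℕ × List Bool)
    (β : ℕ) : Option ℕ :=
  Code.evaln fuel (Denumerable.ofNat Code e.2.1) (Encodable.encode (e.1, jointView l β))

/-- The messages that agree with the partial word `r` in at least `t` positions, as a list. -/
noncomputable def decodingList (n k t : ℕ) (r : ℕ → Option ℕ) : List ℕ :=
  (List.range (crtSize k)).filter fun v =>
    t ≤ ((List.range n).filter fun β => r β = some (v % primeAt β)).length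

/-- The data of a coalition, computed from the programs and the stored strings of its members, and
from the positions of the data in the lists of decodings of the replies. -/
noncomputable def reconstruct (d : (ℕ × ℕ × ℕ) × List (Option (ℕ × ℕ × List Bool))) (fuel : ℕ) :
    Option (List Bool) :=
  -- The list collects the missing replies. Output is produced only when none is missing, so
  -- additional fuel cannot change a result once it has been found.
  if ((members d.2).flatMap fun e => (List.range d.1.1).filter fun β =>
      boundedReply (members d.2) fuel e β = none).length = 0 then
    some ((members d.2).flatMap fun e => fixedWidthBits (crtSize d.1.2.1)
      ((decodingList d.1.1 d.1.2.1 d.1.2.2 (boundedReply (members d.2) fuel e)).getD e.2.2.1 0))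
  else none

/-- The binary code of the arguments of `reconstruct`. -/
def coalitionCode : (ℕ × ℕ × ℕ) × List (Option (ℕ × ℕ × List Bool)) → List Bool :=
  pairCode (pairCode numCode (pairCode numCode numCode))
    (listCode (optionCode (pairCode numCode (pairCode numCode strCode))))

theorem coalitionCode_primrec : Primrec coalitionCode :=
  pairCode_primrec (pairCode_primrec numCode_primrec (pairCode_primrec numCode_primrec
    numCode_primrec)) (listCode_primrec (optionCode_primrec (pairCode_primrec numCode_primrec
      (pairCode_primrec numCode_primrec strCode_primrec))))

theorem coalitionCode_injective : Function.Injective coalitionCode := by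
  have h : PrefixFree coalitionCode :=
    (numCode_prefixFree.pair (numCode_prefixFree.pair numCode_prefixFree)).pair
      (numCode_prefixFree.pair (numCode_prefixFree.pair strCode_prefixFree)).option.list
  exact fun d d' hd => (h d d' [] [] (by rw [hd])).1

theorem members_primrec {α : Type*} [Primcodable α] :
    Primrec (members : List (Option α) → List (ℕ × α)) := by
  refine Primrec.listFilterMap (Primrec.list_range.comp Primrec.list_length) ?_
  have h : Primrec₂ fun (es : List (Option α)) i => es[i]?.join :=
    (Primrec.option_bind Primrec.list_getElem? Primrec.snd.to₂).of_eq fun p => by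
      cases p.1[p.2]? <;> rfl
  exact Primrec.option_map h (Primrec.pair (Primrec.snd.comp Primrec.fst) Primrec.snd).to₂

theorem jointView_primrec : Primrec₂ jointView :=
  Primrec.list_map Primrec.fst (Primrec.pair (Primrec.fst.comp Primrec.snd)
    (Primrec.pair (Primrec.snd.comp Primrec.fst)
      (Primrec.snd.comp (Primrec.snd.comp (Primrec.snd.comp Primrec.snd))))).to₂

theorem boundedReply_primrec {α : Type*} [Primcodable α]
    {l : α → List (ℕ × ℕ × ℕ × List Bool)} {fuel : α → ℕ} {e : α → ℕ × ℕ × ℕ × List Bool}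
    {β : α → ℕ} (hl : Primrec l) (hfuel : Primrec fuel) (he : Primrec e) (hβ : Primrec β) :
    Primrec fun a => boundedReply (l a) (fuel a) (e a) (β a) :=
  Code.primrec_evaln.comp (Primrec.pair (Primrec.pair hfuel
    ((Primrec.ofNat Code).comp (Primrec.fst.comp (Primrec.snd.comp he))))
    (Primrec.encode.comp (Primrec.pair (Primrec.fst.comp he) (jointView_primrec.comp hl hβ))))

theorem decodingList_primrec {α : Type*} [Primcodable α] {n k t : α → ℕ} {r : α → ℕ → Option ℕ}
    (hn : Primrec n) (hk : Primrec k) (ht : Primrec t) (hr : Primrec₂ r) :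
    Primrec fun a => decodingList (n a) (k a) (t a) (r a) := by
  refine Primrec.list_filter_param (R := fun a v =>
    t a ≤ ((List.range (n a)).filter fun β => r a β = some (v % primeAt β)).length)
    (Primrec.list_range.comp (crtSize_primrec.comp hk)) ?_
  refine Primrec.nat_le.comp (ht.comp Primrec.fst) (Primrec.list_length.comp ?_)
  refine Primrec.list_filter_param (R := fun (p : α × ℕ) β => r p.1 β = some (p.2 % primeAt β))
    (Primrec.list_range.comp (hn.comp Primrec.fst)) ?_
  exact Primrec.eq.comp (hr.comp (Primrec.fst.comp Primrec.fst) Primrec.snd)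
    (Primrec.option_some.comp (Primrec.nat_mod.comp (Primrec.snd.comp Primrec.fst)
      (primeAt_primrec.comp Primrec.snd)))

theorem reconstruct_primrec : Primrec₂ reconstruct := by
  have hl : Primrec fun p : ((ℕ × ℕ × ℕ) × List (Option (ℕ × ℕ × List Bool))) × ℕ =>
      members p.1.2 := members_primrec.comp (Primrec.snd.comp Primrec.fst)
  have hn : Primrec fun p : ((ℕ × ℕ × ℕ) × List (Option (ℕ × ℕ × List Bool))) × ℕ =>
      p.1.1.1 := Primrec.fst.comp (Primrec.fst.comp Primrec.fst)
  have hk : Primrec fun p : ((ℕ × ℕ × ℕ) × List (Option (ℕ × ℕ × List Bool))) × ℕ =>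
      p.1.1.2.1 := Primrec.fst.comp (Primrec.snd.comp (Primrec.fst.comp Primrec.fst))
  have ht : Primrec fun p : ((ℕ × ℕ × ℕ) × List (Option (ℕ × ℕ × List Bool))) × ℕ =>
      p.1.1.2.2 := Primrec.snd.comp (Primrec.snd.comp (Primrec.fst.comp Primrec.fst))
  refine Primrec.ite ?_ (Primrec.option_some.comp ?_) (Primrec.const none)
  · refine Primrec.eq.comp (Primrec.list_length.comp ?_) (Primrec.const 0)
    refine Primrec.list_flatMap hl ?_
    refine Primrec.list_filter_param
      (R := fun (q : (((ℕ × ℕ × ℕ) × List (Option (ℕ × ℕ × List Bool))) × ℕ) ×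
        (ℕ × ℕ × ℕ × List Bool)) β => boundedReply (members q.1.1.2) q.1.2 q.2 β = none)
      (Primrec.list_range.comp (hn.comp Primrec.fst)) ?_
    exact Primrec.eq.comp (boundedReply_primrec (hl.comp (Primrec.fst.comp Primrec.fst))
      (Primrec.snd.comp (Primrec.fst.comp Primrec.fst)) (Primrec.snd.comp Primrec.fst)
      Primrec.snd) (Primrec.const none)
  · refine Primrec.list_flatMap hl ?_
    refine fixedWidthBits_primrec.comp (crtSize_primrec.comp (hk.comp Primrec.fst)) ?_
    refine (Primrec.list_getD 0).comp ?_ (Primrec.fst.comp (Primrec.snd.comp (Primrec.snd.comp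
      Primrec.snd)))
    refine decodingList_primrec (hn.comp Primrec.fst) (hk.comp Primrec.fst) (ht.comp Primrec.fst) ?_
    exact boundedReply_primrec (hl.comp (Primrec.fst.comp Primrec.fst))
      (Primrec.snd.comp (Primrec.fst.comp Primrec.fst)) (Primrec.snd.comp Primrec.fst) Primrec.snd

end Reconstruct

/-! ### Complexity bounds from additive optimality -/

theorem IsOptimalMachine.plainComplexity_le {U : List Bool →. List Bool} (hU : IsOptimalMachine U)
    {D : List Bool →. List Bool} (hD : Partrec D) :
    ∃ c : ℕ, ∀ p x, x ∈ D p → plainComplexity U x ≤ p.length + c := by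
  obtain ⟨c, hc⟩ := hU.optimal D hD
  refine ⟨c, fun p x hx => ?_⟩
  obtain ⟨p', hp', hl⟩ := hc p x hx
  exact (Nat.sInf_le (show p'.length ∈ {l | ∃ p : List Bool, x ∈ U p ∧ p.length = l} from
    ⟨p', hp', rfl⟩)).trans hl

theorem IsOptimalMachine.plainComplexity_le_length {U : List Bool →. List Bool}
    (hU : IsOptimalMachine U) : ∃ c : ℕ, ∀ x, plainComplexity U x ≤ x.length + c := by
  obtain ⟨c, hc⟩ := hU.plainComplexity_le (D := fun p => Part.some p) Partrec.some
  exact ⟨c, fun x => hc x x (by simp)⟩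

/-- The decompressor searches through all pairs (d, fuel) for one whose `coalitionCode` is the given
string and whose reconstruction succeeds. Injectivity of the code therefore suffices and no decoder
has to be constructed. The search may stop at any successful fuel, hence the hypothesis that all
successes agree. -/
theorem IsOptimalMachine.plainComplexity_le_coalitionCode {U : List Bool →. List Bool}
    (hU : IsOptimalMachine U) : ∃ c : ℕ, ∀ d x, (∃ fuel, reconstruct d fuel = some x) →
      (∀ fuel x', reconstruct d fuel = some x' → x' = x) →
      plainComplexity U x ≤ (coalitionCode d).length + c := by
  let F : List Bool → ℕ → Option (List Bool) := fun p w =>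
    (Encodable.decode (α := ((ℕ × ℕ × ℕ) × List (Option (ℕ × ℕ × List Bool))) × ℕ) w).bind
      fun q => if coalitionCode q.1 = p then reconstruct q.1 q.2 else none
  have hF : Primrec₂ F := by
    refine Primrec.option_bind (Primrec.decode.comp Primrec.snd) (Primrec.ite (Primrec.eq.comp
      (coalitionCode_primrec.comp (Primrec.fst.comp Primrec.snd))
      (Primrec.fst.comp Primrec.fst)) ?_ (Primrec.const none))
    exact reconstruct_primrec.comp (Primrec.fst.comp Primrec.snd) (Primrec.snd.comp Primrec.snd)
  obtain ⟨c, hc⟩ := hU.plainComplexity_le (D := fun p => Nat.rfindOpt (F p))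
    (Partrec.rfindOpt hF.to_comp)
  refine ⟨c, fun d x ⟨fuel, hfuel⟩ huniq => hc _ _ ?_⟩
  have hdom : (Nat.rfindOpt (F (coalitionCode d))).Dom :=
    Nat.rfindOpt_dom.2 ⟨Encodable.encode (d, fuel), x, by
      simp only [F, Encodable.encodek, Option.bind_some, if_true, hfuel, Option.mem_def]⟩
  obtain ⟨x', hx'⟩ := Part.dom_iff_mem.1 hdom
  obtain ⟨w, hw⟩ := Nat.rfindOpt_spec hx'
  obtain ⟨q, -, hq⟩ := Option.bind_eq_some_iff.1 hw
  split_ifs at hq with h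
  rw [coalitionCode_injective h] at hq
  rwa [← huniq _ _ hq]

/-! ### Correctness of the reconstruction -/

theorem List.filter_finRange_mem {s : ℕ} (T : Finset (Fin s)) :
    (List.finRange s).filter (· ∈ T) = T.sort (· ≤ ·) := by
  have hnd : ((List.finRange s).filter (· ∈ T)).Nodup := (List.nodup_finRange s).filter _
  have hT : ((List.finRange s).filter (· ∈ T)).toFinset = T := by ext; simp
  have h := (List.toFinset_sort (r := (· ≤ ·)) hnd).2 (by
    refine List.Pairwise.filter _ ?_
    exact (List.pairwise_lt_finRange s).imp le_of_lt)
  rw [← h, hT]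

theorem members_ofFn {α : Type*} {s : ℕ} (T : Finset (Fin s)) (f : Fin s → α) :
    members (List.ofFn fun i => if i ∈ T then some (f i) else none) =
      (T.sort (· ≤ ·)).map fun i : Fin s => ((i : ℕ), f i) := by
  rw [members, List.length_ofFn, ← List.map_coe_finRange_eq_range, List.filterMap_map,
    ← List.filter_finRange_mem, ← List.filterMap_eq_map, List.filterMap_filter]
  refine List.filterMap_congr fun i _ => ?_
  by_cases h : i ∈ T <;> simp [h]

theorem reconstruct_eq_none {d : (ℕ × ℕ × ℕ) × List (Option (ℕ × ℕ × List Bool))} {fuel β : ℕ}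
    {e : ℕ × ℕ × ℕ × List Bool} (he : e ∈ members d.2) (hβ : β < d.1.1)
    (h : boundedReply (members d.2) fuel e β = none) : reconstruct d fuel = none := by
  rw [reconstruct, if_neg]
  rw [List.length_eq_zero_iff, List.flatMap_eq_nil_iff]
  intro h0
  have := h0 e he
  rw [List.filter_eq_nil_iff] at this
  exact this β (List.mem_range.2 hβ) (by simpa using h)

theorem decodingList_congr {n k t : ℕ} {r r' : ℕ → Option ℕ} (h : ∀ β < n, r β = r' β) :
    decodingList n k t r = decodingList n k t r' := by
  refine List.filter_congr fun v _ => ?_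
  rw [List.filter_congr fun β hβ => by rw [h β (List.mem_range.1 hβ)]]

theorem reconstruct_eq_some {d : (ℕ × ℕ × ℕ) × List (Option (ℕ × ℕ × List Bool))} {fuel : ℕ}
    {r : ℕ × ℕ × ℕ × List Bool → ℕ → ℕ} (h : ∀ e ∈ members d.2, ∀ β < d.1.1,
      boundedReply (members d.2) fuel e β = some (r e β)) :
    reconstruct d fuel = some ((members d.2).flatMap fun e => fixedWidthBits (crtSize d.1.2.1)
      ((decodingList d.1.1 d.1.2.1 d.1.2.2 fun β => some (r e β)).getD e.2.2.1 0)) := by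
  rw [reconstruct, if_pos]
  · congr 1
    refine List.flatMap_congr fun e he => ?_
    rw [decodingList_congr (h e he)]
  · rw [List.length_eq_zero_iff, List.flatMap_eq_nil_iff]
    intro e he
    rw [List.filter_eq_nil_iff]
    intro β hβ
    simp [h e he β (List.mem_range.1 hβ)]

theorem decodingList_some_length (n k t : ℕ) (r : ℕ → ℕ) :
    (decodingList n k t fun β => some (r β)).length = (decodings n k t r).card := by
  simp only [decodingList, Option.some.injEq]
  rfl

theorem mem_decodingList_some {n k t v : ℕ} {r : ℕ → ℕ} :
    v ∈ decodingList n k t (fun β => some (r β)) ↔ v ∈ decodings n k t r := by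
  simp only [decodingList, Option.some.injEq, decodings, Finset.mem_filter, List.mem_filter,
    Finset.mem_range, List.mem_range, decide_eq_true_eq]
  rfl

/-- The data of a coalition whose replies agree with the codewords in sufficiently many positions
are determined by the programs and the stored strings, and by a small number for each member. -/
theorem exists_reconstruct_of_isPlay {k n s t : ℕ} (hk : 1 ≤ k) (ht : n * (k - 1) < t ^ 2)
    (x : Fin s → Fin (crtSize k)) (T : Finset (Fin s)) (y : Fin s → List Bool)
    (A : Fin s → Nat.Partrec.Code)
    (reply : Fin n → Fin s → Fin (primeAt (n - 1)))
    (hplay : (crtProtocol k n s).IsPlay x T y A reply)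
    (hagree : ∀ i ∈ T, t ≤ (Finset.univ.filter fun β : Fin n =>
      (reply β i : ℕ) = (x i : ℕ) % primeAt β).card) :
    ∃ idx : Fin s → ℕ, (∀ i, idx i ≤ n ^ 2) ∧
      -- The set T is recorded by one optional entry per prover. This costs one bit each, where
      -- explicit indices would cost log s bits per member.
      ∀ d, d = ((n, k, t), List.ofFn fun i : Fin s =>
        if i ∈ T then some (Encodable.encode (A i), idx i, y i) else none) →
      (∃ fuel, reconstruct d fuel = some (chunkString x T)) ∧
      ∀ fuel x', reconstruct d fuel = some x' → x' = chunkString x T := by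
  classical
  let r : Fin s → ℕ → ℕ := fun i β => if h : β < n then (reply ⟨β, h⟩ i : ℕ) else 0
  let l : Fin s → List ℕ := fun i => decodingList n k t fun β => some (r i β)
  have hmem : ∀ i ∈ T, (x i : ℕ) ∈ l i := by
    intro i hi
    rw [mem_decodingList_some, decodings, Finset.mem_filter, Finset.mem_range]
    refine ⟨(x i).isLt, (hagree i hi).trans_eq ?_⟩
    refine Finset.card_bij (fun β _ => (β : ℕ)) ?_ (fun _ _ _ _ h => Fin.ext h) ?_
    · intro β hβ
      simpa [r] using hβ
    · intro β hβ
      simp only [Finset.mem_filter, Finset.mem_range] at hβ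
      exact ⟨⟨β, hβ.1⟩, by simpa [r, hβ.1] using hβ.2, rfl⟩
  -- The position of `x i` in its list of candidates; the list has at most n² entries by the Johnson
  -- bound.
  refine ⟨fun i => (l i).idxOf (x i : ℕ), fun i => List.idxOf_le_length.trans ?_, ?_⟩
  · rw [decodingList_some_length]
    exact card_decodings_le hk ht _
  rintro d rfl
  set d : (ℕ × ℕ × ℕ) × List (Option (ℕ × ℕ × List Bool)) := ((n, k, t), List.ofFn fun i : Fin s =>
        if i ∈ T then some (Encodable.encode (A i), (l i).idxOf (x i : ℕ), y i) else none) with hd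
  have hm : members d.2 = (T.sort (· ≤ ·)).map fun i : Fin s =>
      ((i : ℕ), Encodable.encode (A i), (l i).idxOf (x i : ℕ), y i) := members_ofFn T _
  -- The view rebuilt from the description is the view in the protocol, because every prover
  -- receives the same challenge β. So the programs reproduce exactly the replies of the play.
  have hsound : ∀ i ∈ T, ∀ (β : Fin n) (v : ℕ),
      v ∈ (A i).eval (Encodable.encode ((i : ℕ), jointView (members d.2) β)) ↔
        v = reply β i := by
    intro i hi β v
    have h := (hplay β).2 i hi
    have hview : jointView (members d.2) β = (crtProtocol k n s).coalitionView T y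
        ((crtProtocol k n s).store β x) := by
      rw [hm, jointView, List.map_map]; rfl
    rw [hview]
    exact ⟨fun hv => Part.mem_unique hv h, fun hv => hv ▸ h⟩
  let rr : ℕ × ℕ × ℕ × List Bool → ℕ → ℕ := fun e => if h : e.1 < s then r ⟨e.1, h⟩ else 0
  have hrr : ∀ e ∈ members d.2, ∃ i ∈ T, e = ((i : ℕ), Encodable.encode (A i),
      (l i).idxOf (x i : ℕ), y i) := by
    intro e he
    rw [hm, List.mem_map] at he
    obtain ⟨i, hi, rfl⟩ := he
    exact ⟨i, by simpa using hi, rfl⟩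
  have hbr : ∀ (i : Fin s) (fuel β : ℕ), boundedReply (members d.2) fuel ((i : ℕ),
      Encodable.encode (A i), (l i).idxOf (x i : ℕ), y i) β =
      (A i).evaln fuel (Encodable.encode ((i : ℕ), jointView (members d.2) β)) := by
    intro i fuel β
    rw [boundedReply, Denumerable.ofNat_encode]
  have hsome : ∀ fuel, (∀ e ∈ members d.2, ∀ β < n,
      boundedReply (members d.2) fuel e β ≠ none) →
      reconstruct d fuel = some (chunkString x T) := by
    intro fuel h
    have h' : ∀ e ∈ members d.2, ∀ β < d.1.1,
        boundedReply (members d.2) fuel e β = some (rr e β) := by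
      intro e he β hβ
      obtain ⟨v, hv⟩ := Option.ne_none_iff_exists'.1 (h e he β hβ)
      rw [hv]
      obtain ⟨i, hi, rfl⟩ := hrr e he
      rw [hbr] at hv
      have h1 := (hsound i hi ⟨β, hβ⟩ v).1 (Nat.Partrec.Code.evaln_sound hv)
      have hβ' : β < n := hβ
      simp [rr, r, hβ', h1]
    rw [reconstruct_eq_some h', hm, List.flatMap_map, chunkString, List.flatMap_def]
    congr 2
    refine List.map_congr_left fun i hi => ?_
    have hi' : i ∈ T := by simpa using hi
    have : (decodingList d.1.1 d.1.2.1 d.1.2.2 fun β => some (rr ((i : ℕ),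
      Encodable.encode (A i), (l i).idxOf (x i : ℕ), y i) β)) = l i := by simp [rr, l, hd]
    simp only [this]
    congr 1
    -- The default value 0 is never used, since `x i` occurs in the list.
    rw [List.getD_eq_getElem _ _ (List.idxOf_lt_length_iff.2 (hmem i hi')), List.getElem_idxOf]
  constructor
  · have hex : ∀ i : Fin s, ∀ β : Fin n, ∃ f, i ∈ T → (reply β i : ℕ) ∈
        (A i).evaln f (Encodable.encode ((i : ℕ), jointView (members d.2) β)) := by
      intro i β
      by_cases hi : i ∈ T
      · obtain ⟨f, hf⟩ := Nat.Partrec.Code.evaln_complete.1 ((hsound i hi β _).2 rfl)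
        exact ⟨f, fun _ => hf⟩
      · exact ⟨0, fun h => absurd h hi⟩
    choose f hf using hex
    -- Every required computation halts. The sum of the individual fuels dominates each of them, and
    -- `evaln` is monotone in the fuel.
    refine ⟨∑ i, ∑ β, f i β, hsome _ fun e he β hβ => ?_⟩
    obtain ⟨i, hi, rfl⟩ := hrr e he
    rw [hbr]
    have hle : f i ⟨β, hβ⟩ ≤ ∑ i, ∑ β, f i β :=
      (Finset.single_le_sum (f := fun β => f i β) (fun _ _ => Nat.zero_le _)
        (Finset.mem_univ _)).trans (Finset.single_le_sum (f := fun i => ∑ β, f i β)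
          (fun _ _ => Nat.zero_le _) (Finset.mem_univ i))
    have := Nat.Partrec.Code.evaln_mono hle (hf i ⟨β, hβ⟩ hi)
    rw [Option.mem_def] at this
    rw [this]
    simp
  · intro fuel x' hx'
    by_cases h : ∀ e ∈ members d.2, ∀ β < n, boundedReply (members d.2) fuel e β ≠ none
    · rw [hsome fuel h] at hx'
      exact (Option.some.inj hx').symm
    · push Not at h
      obtain ⟨e, he, β, hβ, h⟩ := h
      rw [reconstruct_eq_none he hβ h] at hx'
      cases hx'

/-! ### Lengths of descriptions -/

theorem Nat.size_mul_le (m n : ℕ) : Nat.size (m * n) ≤ Nat.size m + Nat.size n := by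
  rw [Nat.size_le, pow_add]
  exact Nat.mul_lt_mul'' (Nat.lt_size_self m) (Nat.lt_size_self n)

/-- A linear majorant of the binary length with slope 1/m, which permits summing lengths without a
concavity argument. -/
theorem Nat.size_le_add_div {m : ℕ} (hm : 0 < m) (v : ℕ) :
    Nat.size v ≤ Nat.size m + v / m + 1 := by
  have h1 : v ≤ m * (v / m + 1) := (Nat.lt_mul_div_succ v hm).le
  have h2 : Nat.size (v / m + 1) ≤ v / m + 1 := Nat.size_le.2 Nat.lt_two_pow_self
  have := (Nat.size_le_size h1).trans (Nat.size_mul_le _ _)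
  omega

theorem Nat.size_le_logb_add_one {n : ℕ} (hn : 0 < n) : (Nat.size n : ℝ) ≤ Real.logb 2 n + 1 := by
  have h0 : 0 < Nat.size n := Nat.size_pos.2 hn
  have h : 2 ^ (Nat.size n - 1) ≤ n := Nat.lt_size.1 (by omega)
  have h2 : ((Nat.size n - 1 : ℕ) : ℝ) ≤ Real.logb 2 n :=
    two_pow_le_iff_logb (by exact_mod_cast hn) (by rw [Real.rpow_natCast]; exact_mod_cast h)
  rw [Nat.cast_sub h0] at h2
  push_cast at h2
  linarith

theorem size_crtSize_le {k : ℕ} (hk : 1 ≤ k) : Nat.size (crtSize k) ≤ 4 * k ^ 2 := by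
  have h : crtSize k ≤ (2 ^ (2 * k + 1)) ^ k := by
    rw [crtSize]
    refine (Finset.prod_le_pow_card _ _ (2 ^ (2 * k + 1)) fun i hi => ?_).trans_eq (by simp)
    have hik : i + 1 ≤ k := Finset.mem_range.1 hi
    have h1 : k ≤ 2 ^ k := Nat.lt_two_pow_self.le
    calc primeAt i ≤ 2 * (i + 1) ^ 2 := primeAt_le_sq i
      _ ≤ 2 * (2 ^ k) ^ 2 := by gcongr; omega
      _ = 2 ^ (2 * k + 1) := by rw [← pow_mul, pow_succ, mul_comm, mul_comm k]
  have h2 : Nat.size (crtSize k) ≤ (2 * k + 1) * k + 1 := by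
    rw [Nat.size_le, pow_succ, pow_mul]
    have : 0 < (2 ^ (2 * k + 1)) ^ k := by positivity
    omega
  nlinarith

theorem chunkString_length_le {s k n : ℕ} (hk : 1 ≤ k) (hkn : k ≤ n)
    (x : Fin s → Fin (crtSize k)) (T : Finset (Fin s)) :
    (chunkString x T).length ≤ s * (4 * n ^ 2) := by
  have h : Nat.size (crtSize k - 1) ≤ 4 * n ^ 2 :=
    (Nat.size_le_size (Nat.sub_le _ _)).trans ((size_crtSize_le hk).trans (by gcongr))
  have hT : T.card ≤ s := by simpa using Finset.card_le_univ T
  calc (chunkString x T).length = T.card * Nat.size (crtSize k - 1) := by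
        simp [chunkString, fixedWidthBits, List.length_flatten, Function.comp_def]
    _ ≤ s * (4 * n ^ 2) := Nat.mul_le_mul hT h

/-- The self-delimiting headers of the stored strings cost O(log n) bits per prover on average: the
linear majorant of slope 1/(4n²) is summed, and the total length divided by 4n² is at most s + c. -/
theorem sum_size_length_le {s n c : ℕ} (hn : 1 ≤ n) (T : Finset (Fin s)) (y : Fin s → List Bool)
    (hy : ∑ i ∈ T, (y i).length ≤ s * (4 * n ^ 2) + c) :
    ∑ i ∈ T, Nat.size (y i).length ≤ s * (2 * Nat.size n + 5) + c := by
  have hM : 0 < 4 * n ^ 2 := by positivity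
  have hT : T.card ≤ s := by simpa using Finset.card_le_univ T
  have h1 : ∑ i ∈ T, (y i).length / (4 * n ^ 2) ≤ s + c := by
    have h2 : ∑ i ∈ T, (y i).length / (4 * n ^ 2) ≤
        (∑ i ∈ T, (y i).length) / (4 * n ^ 2) := by
      rw [Nat.le_div_iff_mul_le hM, Finset.sum_mul]
      exact Finset.sum_le_sum fun i _ => Nat.div_mul_le_self _ _
    refine h2.trans ((Nat.div_le_div_right hy).trans ?_)
    rw [Nat.mul_comm s, Nat.mul_add_div hM]
    exact Nat.add_le_add_left (Nat.div_le_self _ _) _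
  have h3 : Nat.size (4 * n ^ 2) ≤ 2 * Nat.size n + 3 := by
    have e1 := Nat.size_mul_le 4 (n * n)
    have e2 := Nat.size_mul_le n n
    have e3 : Nat.size 4 = 3 := by decide
    rw [sq]; omega
  calc ∑ i ∈ T, Nat.size (y i).length
      ≤ ∑ i ∈ T, ((2 * Nat.size n + 4) + (y i).length / (4 * n ^ 2)) :=
        Finset.sum_le_sum fun i _ => by
          have := Nat.size_le_add_div hM (y i).length
          omega
    _ = T.card * (2 * Nat.size n + 4) + ∑ i ∈ T, (y i).length / (4 * n ^ 2) := by
        rw [Finset.sum_add_distrib]; simp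
    _ ≤ s * (2 * Nat.size n + 4) + (s + c) := by gcongr
    _ = _ := by ring

/-- Of the factor 14, six come from n, k and t, four from the position below n², and four from the
lengths of the strings. The constant 20 collects the markers, the headers and the code of s itself,
with `Nat.size s` ≤ s. -/
theorem coalitionCode_length_le {n k t s a c : ℕ} (hn : 1 ≤ n) (hkn : k ≤ n) (htn : t ≤ n)
    (hs : 1 ≤ s) (T : Finset (Fin s)) (y : Fin s → List Bool) (code idx : Fin s → ℕ)
    (hcode : ∀ i ∈ T, Nat.size (code i) ≤ a) (hidx : ∀ i, idx i ≤ n ^ 2)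
    (hy : ∑ i ∈ T, (y i).length ≤ s * (4 * n ^ 2) + c) :
    (coalitionCode ((n, k, t), List.ofFn fun i : Fin s =>
      if i ∈ T then some (code i, idx i, y i) else none)).length ≤
      ∑ i ∈ T, (y i).length + s * (14 * Nat.size n + 2 * a + 20) + 2 * c := by
  have hidx' : ∀ i, Nat.size (idx i) ≤ 2 * Nat.size n := by
    intro i
    have := (Nat.size_le_size (hidx i)).trans_eq (by rw [sq])
    have := Nat.size_mul_le n n
    omega
  have hs' : Nat.size s ≤ s := Nat.size_le.2 Nat.lt_two_pow_self
  have hT : T.card ≤ s := by simpa using Finset.card_le_univ T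
  have h1 := Nat.size_le_size hkn
  have h2 := Nat.size_le_size htn
  have hsum : ∑ i : Fin s, (optionCode (pairCode numCode (pairCode numCode strCode))
      (if i ∈ T then some (code i, idx i, y i) else none)).length =
      s + ∑ i ∈ T, (2 * Nat.size (code i) + 2 * Nat.size (idx i) + 3 +
        (2 * Nat.size (y i).length + (y i).length)) := by
    have : ∀ i : Fin s, (optionCode (pairCode numCode (pairCode numCode strCode))
      (if i ∈ T then some (code i, idx i, y i) else none)).length =
        1 + if i ∈ T then (2 * Nat.size (code i) + 2 * Nat.size (idx i) + 3 +
          (2 * Nat.size (y i).length + (y i).length)) else 0 := by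
      intro i
      by_cases h : i ∈ T
      · simp [h, optionCode, pairCode, numCode_length, strCode_length]; ring
      · simp [h, optionCode]
    simp_rw [this]
    rw [Finset.sum_add_distrib]
    simp
  have hsum2 : ∑ i ∈ T, (2 * Nat.size (code i) + 2 * Nat.size (idx i) + 3 +
        (2 * Nat.size (y i).length + (y i).length)) ≤
      s * (2 * a + 4 * Nat.size n + 3) +
        (2 * (s * (2 * Nat.size n + 5) + c) + ∑ i ∈ T, (y i).length) := by
    rw [Finset.sum_add_distrib, Finset.sum_add_distrib (s := T) (g := fun i => (y i).length),
      ← Finset.mul_sum]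
    refine Nat.add_le_add ?_ (Nat.add_le_add_right (Nat.mul_le_mul_left _
      (sum_size_length_le hn T y hy)) _)
    refine (Finset.sum_le_card_nsmul T _ (2 * a + 4 * Nat.size n + 3) fun i hi => ?_).trans ?_
    · have := hcode i hi
      have := hidx' i
      omega
    · rw [smul_eq_mul]; gcongr
  have hlen : (coalitionCode ((n, k, t), List.ofFn fun i : Fin s =>
      if i ∈ T then some (code i, idx i, y i) else none)).length =
      (2 * Nat.size n + 1) + (2 * Nat.size k + 1) + (2 * Nat.size t + 1) + (2 * Nat.size s + 1) +
      ∑ i : Fin s, (optionCode (pairCode numCode (pairCode numCode strCode))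
        (if i ∈ T then some (code i, idx i, y i) else none)).length := by
    simp only [coalitionCode, pairCode, listCode, List.length_append, numCode_length,
      List.length_ofFn, List.length_flatMap, List.map_ofFn, List.sum_ofFn, Function.comp_def]
    ring
  rw [hlen, hsum]
  have : Nat.size n ≤ s * Nat.size n := Nat.le_mul_of_pos_left _ hs
  nlinarith

/-! ### The resource bound and the verification guarantee -/

/-- The function l - log l - 1 vanishes at l = 2, and its increments beyond b > 2 have slope at
least 1/4 by the tangent estimate. It is thus positive at b and stays above a line through the
origin. This is where B > 4 enters. -/
theorem exists_mul_le_sub_logb {b : ℝ} (hb : 2 < b) :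
    ∃ δ : ℝ, 0 < δ ∧ ∀ l, b ≤ l → δ * l ≤ l - Real.logb 2 l - 1 := by
  have hlog2 : Real.logb 2 2 = 1 := Real.logb_self_eq_one (by norm_num)
  have h1 := logb_two_le_tangent (x := b) (q := 2) (by linarith) (by norm_num) hb.le
  rw [hlog2] at h1
  have hg : 0 < b - Real.logb 2 b - 1 := by linarith
  refine ⟨min ((b - Real.logb 2 b - 1) / b) (1 / 4), lt_min (by positivity) (by norm_num),
    fun l hl => ?_⟩
  have h2 := logb_two_le_tangent (x := l) (q := b) (by linarith) (by linarith) hl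
  have h3 : 3 / 2 * (l / b - 1) ≤ 3 / 4 * (l - b) := by
    have : l / b - 1 ≤ (l - b) / 2 := by
      rw [show l / b - 1 = (l - b) / b by field_simp]
      exact div_le_div_of_nonneg_left (by linarith) (by norm_num) hb.le
    linarith
  have h4 : min ((b - Real.logb 2 b - 1) / b) (1 / 4) * b ≤ b - Real.logb 2 b - 1 := by
    calc _ ≤ (b - Real.logb 2 b - 1) / b * b := by gcongr; exact min_le_left _ _
      _ = _ := by field_simp
  have h5 : min ((b - Real.logb 2 b - 1) / b) (1 / 4) * (l - b) ≤ 1 / 4 * (l - b) :=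
    mul_le_mul_of_nonneg_right (min_le_right _ _) (by linarith)
  nlinarith

/-! ### Consequences of the choice n = ⌊k/ε²⌋ -/

section Parameters

variable {k : ℕ} {ε : ℝ}

theorem div_le_div_sq (hε : 0 < ε) (hε1 : ε ≤ 1) : (k : ℝ) / ε ≤ k / ε ^ 2 := by
  have : ε ^ 2 ≤ ε := by nlinarith
  gcongr

theorem le_floor_div_sq (hε : 0 < ε) (hε1 : ε ≤ 1) : k ≤ ⌊(k : ℝ) / ε ^ 2⌋₊ := by
  refine Nat.le_floor ?_
  rw [le_div_iff₀ (by positivity)]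
  have : ε ^ 2 ≤ 1 := by nlinarith
  nlinarith [(Nat.cast_nonneg k : (0 : ℝ) ≤ k)]

theorem logb_primeAt_floor_le {m : ℝ} (hm : 4 ≤ m) :
    Real.logb 2 (primeAt (⌊m⌋₊ - 1)) ≤ Real.logb 2 m + 1 + Real.logb 2 (Real.logb 2 m) := by
  have hn : 4 ≤ ⌊m⌋₊ := Nat.le_floor (by exact_mod_cast hm)
  have hnm : (⌊m⌋₊ : ℝ) ≤ m := Nat.floor_le (by linarith)
  have hn4 : (4 : ℝ) ≤ ⌊m⌋₊ := by exact_mod_cast hn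
  have hp : (0 : ℝ) < primeAt (⌊m⌋₊ - 1) := by exact_mod_cast (primeAt_prime _).pos
  have hlog : 0 < Real.logb 2 (⌊m⌋₊ : ℝ) := Real.logb_pos (by norm_num) (by linarith)
  have hlogm : Real.logb 2 (⌊m⌋₊ : ℝ) ≤ Real.logb 2 m :=
    Real.logb_le_logb_of_le (by norm_num) (by linarith) hnm
  have h : (primeAt (⌊m⌋₊ - 1) : ℝ) ≤ 2 * m * Real.logb 2 m :=
    (primeAt_le_two_mul_logb hn).trans (by gcongr)
  refine (Real.logb_le_logb_of_le (by norm_num) hp h).trans_eq ?_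
  rw [Real.logb_mul (by positivity) (by linarith), Real.logb_mul (by norm_num) (by linarith),
    Real.logb_self_eq_one (by norm_num)]
  ring

/-- From k < ε²(n + 1) and ε ≤ 1 follows k - 1 < ε²n, so n(k - 1) < (εn)² ≤ g², the condition of the
Johnson bound. -/
theorem lt_sq_of_accept {g : ℕ} (hk : 1 ≤ k) (hε : 0 < ε) (hε1 : ε ≤ 1)
    (hg : ε * ⌊(k : ℝ) / ε ^ 2⌋₊ ≤ g) : ⌊(k : ℝ) / ε ^ 2⌋₊ * (k - 1) < g ^ 2 := by
  have hn : 0 < ⌊(k : ℝ) / ε ^ 2⌋₊ := lt_of_lt_of_le hk (le_floor_div_sq hε hε1)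
  have h1 := Nat.lt_floor_add_one ((k : ℝ) / ε ^ 2)
  generalize ⌊(k : ℝ) / ε ^ 2⌋₊ = n at *
  have hn' : (0 : ℝ) < n := by exact_mod_cast hn
  rw [div_lt_iff₀ (by positivity)] at h1
  have h2 : (k : ℝ) - 1 < ε ^ 2 * n := by nlinarith
  have h3 : (n : ℝ) * (k - 1) < g ^ 2 :=
    calc (n : ℝ) * (k - 1) < n * (ε ^ 2 * n) := by gcongr
      _ = (ε * n) ^ 2 := by ring
      _ ≤ _ := by gcongr
  have : ((n * (k - 1) : ℕ) : ℝ) < ((g ^ 2 : ℕ) : ℝ) := by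
    push_cast [Nat.cast_sub hk]; exact h3
  exact_mod_cast this

end Parameters

theorem crtProtocol_replyBits (k n s : ℕ) :
    (crtProtocol k n s).replyBits = s * Real.logb 2 (primeAt (n - 1)) := rfl

theorem crtProtocol_communicationBits (k n s : ℕ) : (crtProtocol k n s).communicationBits =
    s * Real.logb 2 n + s * Real.logb 2 (primeAt (n - 1)) := rfl

theorem crtProtocol_storageBits {n : ℕ} (k s : ℕ) (hn : 0 < n) :
    (crtProtocol k n s).storageBits = Real.logb 2 n + s * Real.logb 2 (primeAt (n - 1)) := by
  have hcard : Fintype.card (crtProtocol k n s).State = n * primeAt (n - 1) ^ s := by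
    have : Fintype.card (Fin n × (Fin s → Fin (primeAt (n - 1)))) = n * primeAt (n - 1) ^ s := by
      simp
    rw [← this]
    rfl
  have hp : (primeAt (n - 1) : ℝ) ≠ 0 := by exact_mod_cast (primeAt_prime _).ne_zero
  rw [Protocol.storageBits, hcard]
  push_cast
  rw [Real.logb_mul (by positivity) (by positivity), Real.logb_pow]

/-- If a coalition is accepted by many of the coins, then the complexity of its data is not much
larger than the total length of the strings it stores. -/
theorem IsOptimalMachine.exists_plainComplexity_le {U : List Bool →. List Bool}
    (hU : IsOptimalMachine U) (a : ℕ) : ∃ c : ℕ, ∀ {k n s g : ℕ}, 1 ≤ k → 1 ≤ s → k ≤ n →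
      n * (k - 1) < g ^ 2 → ∀ (x : Fin s → Fin (crtSize k)) (T : Finset (Fin s))
      (y : Fin s → List Bool) (A : Fin s → Nat.Partrec.Code)
      (reply : Fin n → Fin s → Fin (primeAt (n - 1))),
      (∀ i ∈ T, programLength (A i) ≤ a) → (crtProtocol k n s).IsPlay x T y A reply →
      g = (Finset.univ.filter fun ω : Fin n =>
        (crtProtocol k n s).accept ((crtProtocol k n s).store ω x) (reply ω) = true).card →
      plainComplexity U (chunkString x T) ≤
        ∑ i ∈ T, (y i).length + s * (14 * Nat.size n + 2 * a + 20) + c := by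
  obtain ⟨c, hc⟩ := hU.plainComplexity_le_length
  obtain ⟨c', hc'⟩ := hU.plainComplexity_le_coalitionCode
  refine ⟨2 * c + c', fun {k n s g} hk hs hkn hg x T y A reply hA hplay hgdef => ?_⟩
  have hlen := hc (chunkString x T)
  have hxl := chunkString_length_le hk hkn x T
  -- If the stored strings are longer than the data by more than c, the trivial description of x_T
  -- already suffices. Otherwise their headers are short.
  rcases le_or_gt (∑ i ∈ T, (y i).length) (s * (4 * n ^ 2) + c) with hy | hy
  · obtain ⟨idx, hidx, hrec⟩ := exists_reconstruct_of_isPlay hk hg x T y A reply hplay (by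
      intro i _
      rw [hgdef]
      -- Acceptance demands that all replies be correct, so every accepting coin is an agreement
      -- position of each member at once.
      refine Finset.card_le_card fun ω hω => ?_
      rw [Finset.mem_filter] at hω ⊢
      refine ⟨hω.1, ?_⟩
      have h := of_decide_eq_true hω.2
      rw [h]
      rfl)
    obtain ⟨h1, h2⟩ := hrec _ rfl
    have h3 := hc' _ _ h1 h2
    have h4 := coalitionCode_length_le (k := k) (t := g) (hk.trans hkn) hkn
      (hgdef.trans_le ((Finset.card_le_univ _).trans_eq (Fintype.card_fin n))) hs T y
      (fun i => Encodable.encode (A i)) idx hA hidx hy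
    omega
  · omega

theorem crtProtocol_complete {k n s : ℕ} (ω : Fin (crtProtocol k n s).coins)
    (x : Fin s → Fin (crtSize k)) :
    (crtProtocol k n s).accept ((crtProtocol k n s).store ω x) (fun i =>
      (crtProtocol k n s).honest i ((crtProtocol k n s).challenge
        ((crtProtocol k n s).store ω x) i) (x i)) = true := by
  simp only [crtProtocol, decide_eq_true_eq]

theorem crtProtocol_isVerificationProtocol {U : List Bool →. List Bool} (hU : IsOptimalMachine U)
    (a : ℕ) {B : ℝ} (hB : 4 < B) :
    ∃ c₀ c₁ c₂ : ℕ, 0 < c₀ ∧ 0 < c₁ ∧ 0 < c₂ ∧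
      ∀ (k s : ℕ) (ε : ℝ), 1 ≤ k → 1 ≤ s → 0 < ε → ε ≤ 1 → B ≤ k / ε →
        (crtProtocol k ⌊(k : ℝ) / ε ^ 2⌋₊ s).IsVerificationProtocol s
          ((s + 1) * Real.logb 2 k + s - (s + 1) * Real.logb 2 (ε ^ 2)
            + s * Real.logb 2 (Real.logb 2 (k / ε ^ 2)))
          (2 * s * Real.logb 2 k - 2 * s * Real.logb 2 (ε ^ 2) + s
            + s * Real.logb 2 (Real.logb 2 (k / ε ^ 2)))
          a ε
          (fun z => plainComplexity U z
            - c₀ * (s * (Real.logb 2 (k / ε) - Real.logb 2 (Real.logb 2 (k / ε)) - 1))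
            - c₁ * Real.logb 2 (Real.logb 2 (Real.logb 2 (k / ε)))
            - c₂) ∧
        (crtProtocol k ⌊(k : ℝ) / ε ^ 2⌋₊ s).replyBits ≤
          s * Real.logb 2 k - s * Real.logb 2 (ε ^ 2) + s
            + s * Real.logb 2 (Real.logb 2 (k / ε ^ 2)) := by
  have hlog4 : Real.logb 2 4 = 2 := by
    rw [show (4 : ℝ) = 2 ^ (2 : ℝ) by norm_num, Real.logb_rpow (by norm_num) (by norm_num)]
  have hb : 2 < Real.logb 2 B :=
    hlog4.symm.trans_lt (Real.logb_lt_logb (by norm_num) (by norm_num) hB)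
  obtain ⟨δ, hδ, hδl⟩ := exists_mul_le_sub_logb hb
  obtain ⟨c, hc⟩ := hU.exists_plainComplexity_le a
  -- For l = log(k/ε) > 2 and `Nat.size n` ≤ 2l + 1, the overhead 14 `Nat.size n` + 2a + 20 per
  -- prover is at most (45 + a)l. The triple logarithm is nonnegative, so any positive c₁ serves.
  refine ⟨⌈(45 + a) / δ⌉₊, 1, c + 1, Nat.ceil_pos.2 (by positivity), one_pos, Nat.succ_pos _, ?_⟩
  intro k s ε hk hs hε hε1 hBk
  have hk' : (1 : ℝ) ≤ k := by exact_mod_cast hk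
  have hs' : (1 : ℝ) ≤ s := by exact_mod_cast hs
  have hK : 4 < (k : ℝ) / ε := hB.trans_le hBk
  have hm : 4 < (k : ℝ) / ε ^ 2 := hK.trans_le (div_le_div_sq hε hε1)
  have hkn := le_floor_div_sq (k := k) hε hε1
  have hn := hk.trans hkn
  have hn0 : (0 : ℝ) < ⌊(k : ℝ) / ε ^ 2⌋₊ := by exact_mod_cast hn
  have hlogp := mul_le_mul_of_nonneg_left (logb_primeAt_floor_le hm.le) (by linarith : 0 ≤ (s : ℝ))
  have hlogn : Real.logb 2 ⌊(k : ℝ) / ε ^ 2⌋₊ ≤ Real.logb 2 (k / ε ^ 2) :=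
    Real.logb_le_logb_of_le (by norm_num) hn0 (Nat.floor_le (by positivity))
  have hlogn' := mul_le_mul_of_nonneg_left hlogn (by linarith : 0 ≤ (s : ℝ))
  have hlogm : Real.logb 2 ((k : ℝ) / ε ^ 2) = Real.logb 2 k - Real.logb 2 (ε ^ 2) :=
    Real.logb_div (by positivity) (by positivity)
  -- Since k ≥ 1, k/ε² is at most (k/ε)².
  have hll : Real.logb 2 ((k : ℝ) / ε ^ 2) ≤ 2 * Real.logb 2 (k / ε) := by
    rw [← Nat.cast_ofNat, ← Real.logb_pow]
    refine Real.logb_le_logb_of_le (by norm_num) (by positivity) ?_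
    rw [div_pow]
    gcongr
    nlinarith
  generalize Real.logb 2 (Real.logb 2 ((k : ℝ) / ε ^ 2)) = ll at *
  refine ⟨⟨fun ω x => crtProtocol_complete ω x, ?_, ?_, ?_⟩, ?_⟩
  · rw [crtProtocol_storageBits k s hn]
    rw [hlogm] at hlogp hlogn
    linarith
  · rw [crtProtocol_communicationBits]
    rw [hlogm] at hlogp hlogn'
    linarith
  · intro x T y A reply _ hA hplay hacc
    set g := (Finset.univ.filter fun ω : Fin ⌊(k : ℝ) / ε ^ 2⌋₊ =>
      (crtProtocol k ⌊(k : ℝ) / ε ^ 2⌋₊ s).accept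
        ((crtProtocol k ⌊(k : ℝ) / ε ^ 2⌋₊ s).store ω x) (reply ω) = true).card with hg
    have hacc' : ε ≤ (g : ℝ) / ⌊(k : ℝ) / ε ^ 2⌋₊ := hacc
    rw [le_div_iff₀ hn0] at hacc'
    have hC := hc hk hs hkn (lt_sq_of_accept hk hε hε1 hacc') x T y A reply hA hplay hg
    have hC' : (plainComplexity U (chunkString x T) : ℝ) ≤ ((∑ i ∈ T, (y i).length : ℕ) : ℝ) +
        s * (14 * Nat.size ⌊(k : ℝ) / ε ^ 2⌋₊ + 2 * a + 20) + c := by exact_mod_cast hC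
    have hsize := Nat.size_le_logb_add_one (n := ⌊(k : ℝ) / ε ^ 2⌋₊) hn
    have hl := hδl _ (Real.logb_le_logb_of_le (b := 2) (by norm_num) (by linarith) hBk)
    have hl2 : 2 < Real.logb 2 ((k : ℝ) / ε) :=
      hb.trans_le (Real.logb_le_logb_of_le (by norm_num) (by linarith) hBk)
    generalize Real.logb 2 ((k : ℝ) / ε) = l at *
    have hlll : 0 ≤ Real.logb 2 (Real.logb 2 l) := by
      refine Real.logb_nonneg (by norm_num) ?_
      rw [Real.le_logb_iff_rpow_le (by norm_num) (by linarith)]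
      norm_num
      linarith
    have hceil := Nat.le_ceil ((45 + (a : ℝ)) / δ)
    have hmain : (14 * Nat.size ⌊(k : ℝ) / ε ^ 2⌋₊ + 2 * a + 20 : ℝ) ≤
        ⌈(45 + (a : ℝ)) / δ⌉₊ * (l - Real.logb 2 l - 1) :=
      calc (14 * Nat.size ⌊(k : ℝ) / ε ^ 2⌋₊ + 2 * a + 20 : ℝ) ≤ (45 + a) * l := by
            nlinarith [(Nat.cast_nonneg a : (0 : ℝ) ≤ a)]
        _ = (45 + a) / δ * (δ * l) := by field_simp
        _ ≤ _ := by gcongr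
    have hmain' := mul_le_mul_of_nonneg_left hmain (by linarith : 0 ≤ (s : ℝ))
    push_cast at hC' ⊢
    linarith
  · rw [crtProtocol_replyBits]
    rw [hlogm] at hlogp
    linarith

/-! ### Reasoning about programs for random access machines -/

namespace Ram

@[simp] theorem Config.setReg_reg (S : Config) (r v i : ℕ) :
    (S.setReg r v).reg i = if i = r then v else S.reg i := by
  simp [Config.setReg, Function.update_apply]

@[simp] theorem Config.setReg_mem (S : Config) (r v : ℕ) : (S.setReg r v).mem = S.mem := rfl

@[simp] theorem Config.setMem_reg (S : Config) (i v : ℕ) : (S.setMem i v).reg = S.reg := rfl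

@[simp] theorem Config.setMem_mem (S : Config) (i v j : ℕ) :
    (S.setMem i v).mem j = if j = i then v else S.mem j := by
  simp [Config.setMem, Function.update_apply]

theorem lg_mono {v w : ℕ} (h : v ≤ w) : lg v ≤ lg w :=
  Nat.add_le_add_right (Nat.size_le_size h) 1

/-- Started in `S`, the program `c` halts within time `t` in a configuration that satisfies `Q`. -/
def Runs (c : Ram) (S : Config) (t : ℕ) (Q : Config → Prop) : Prop :=
  ∃ S' τ, Exec c S S' τ ∧ τ ≤ t ∧ Q S'

theorem Runs.mono {c : Ram} {S : Config} {t t' : ℕ} {Q Q' : Config → Prop} (h : Runs c S t Q)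
    (ht : t ≤ t') (hQ : ∀ S', Q S' → Q' S') : Runs c S t' Q' := by
  obtain ⟨S', τ, h1, h2, h3⟩ := h
  exact ⟨S', τ, h1, h2.trans ht, hQ _ h3⟩

theorem Runs.seq {c d : Ram} {S : Config} {t t' : ℕ} {Q R : Config → Prop} (h : Runs c S t Q)
    (h' : ∀ S', Q S' → Runs d S' t' R) : Runs (.seq c d) S (t + t') R := by
  obtain ⟨S', τ, h1, h2, h3⟩ := h
  obtain ⟨S'', τ', h1', h2', h3'⟩ := h' S' h3
  exact ⟨S'', τ + τ', .seq h1 h1', by omega, h3'⟩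

/-- The rule for loops, with an invariant `I`, a variant `v`, and bounds for the cost of the test
and of the body. -/
theorem Runs.loop {r : ℕ} {c : Ram} {b t : ℕ} {I : Config → Prop} (v : Config → ℕ)
    (hb : ∀ S, I S → lg (S.reg r) ≤ b)
    (hc : ∀ S, I S → S.reg r ≠ 0 → Runs c S t fun S' => I S' ∧ v S' < v S) {S : Config}
    (hS : I S) : Runs (.loop r c) S (v S * (b + t) + b) fun S' => I S' ∧ S'.reg r = 0 := by
  generalize hm : v S = m
  induction m using Nat.strong_induction_on generalizing S with
  | _ m ih =>
    by_cases h0 : S.reg r = 0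
    · exact ⟨S, _, .loop_done h0, (hb S hS).trans (Nat.le_add_left _ _), hS, h0⟩
    · obtain ⟨S₁, τ₁, e₁, ht₁, hI, hv⟩ := hc S hS h0
      obtain ⟨S₂, τ₂, e₂, ht₂, hQ⟩ := ih (v S₁) (hm ▸ hv) hI rfl
      refine ⟨S₂, _, .loop_step h0 e₁ e₂, ?_, hQ⟩
      have h1 := hb S hS
      have h2 : (v S₁ + 1) * (b + t) ≤ m * (b + t) := Nat.mul_le_mul_right _ (hm ▸ hv)
      rw [add_mul, one_mul] at h2
      omega

/-- The effect of a program without loops. -/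
def step : Ram → Config → Config
  | .const r v, S => S.setReg r v
  | .add r a b, S => S.setReg r (S.reg a + S.reg b)
  | .sub r a b, S => S.setReg r (S.reg a - S.reg b)
  | .mul r a b, S => S.setReg r (S.reg a * S.reg b)
  | .div r a b, S => S.setReg r (S.reg a / S.reg b)
  | .load r a, S => S.setReg r (S.mem (S.reg a))
  | .store a b, S => S.setMem (S.reg a) (S.reg b)
  | .seq c d, S => step d (step c S)
  | .cond r c d, S => if S.reg r = 0 then step d S else step c S
  | .loop _ _, S => S

/-- The program has no loops, and all the numbers and addresses that it handles are at most `V`. -/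
def Fits (V : ℕ) : Ram → Config → Prop
  | .const _ v, _ => v ≤ V
  | .add _ a b, S => S.reg a ≤ V ∧ S.reg b ≤ V
  | .sub _ a b, S => S.reg a ≤ V ∧ S.reg b ≤ V
  | .mul _ a b, S => S.reg a ≤ V ∧ S.reg b ≤ V
  | .div _ a b, S => S.reg a ≤ V ∧ S.reg b ≤ V
  | .load _ a, S => S.reg a ≤ V ∧ S.mem (S.reg a) ≤ V
  | .store a b, S => S.reg a ≤ V ∧ S.reg b ≤ V
  | .seq c d, S => Fits V c S ∧ Fits V d (step c S)
  | .cond r c d, S => S.reg r ≤ V ∧ if S.reg r = 0 then Fits V d S else Fits V c S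
  | .loop _ _, _ => False

/-- The number of instructions of a program without loops. -/
def len : Ram → ℕ
  | .seq c d => len c + len d
  | .cond _ c d => 1 + len c + len d
  | _ => 1

/-- An elementary instruction handles at most two numbers, each of cost at most `lg V`. Verifying a
loop-free program is thereby reduced to evaluating `step` and `Fits` by simplification. -/
theorem Fits.runs {V : ℕ} {c : Ram} {S : Config} (h : Fits V c S) :
    Runs c S (len c * (2 * lg V)) (· = step c S) := by
  induction c generalizing S with
  | const r v => exact ⟨_, _, .const S r v, by have := lg_mono h; simp only [len]; omega, rfl⟩
  | add r a b =>
    exact ⟨_, _, .add S r a b, by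
      have := lg_mono h.1; have := lg_mono h.2; simp only [len]; omega, rfl⟩
  | sub r a b =>
    exact ⟨_, _, .sub S r a b, by
      have := lg_mono h.1; have := lg_mono h.2; simp only [len]; omega, rfl⟩
  | mul r a b =>
    exact ⟨_, _, .mul S r a b, by
      have := lg_mono h.1; have := lg_mono h.2; simp only [len]; omega, rfl⟩
  | div r a b =>
    exact ⟨_, _, .div S r a b, by
      have := lg_mono h.1; have := lg_mono h.2; simp only [len]; omega, rfl⟩
  | load r a =>
    exact ⟨_, _, .load S r a, by
      have := lg_mono h.1; have := lg_mono h.2; simp only [len]; omega, rfl⟩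
  | store a b =>
    exact ⟨_, _, .store S a b, by
      have := lg_mono h.1; have := lg_mono h.2; simp only [len]; omega, rfl⟩
  | seq c d ihc ihd =>
    refine ((ihc h.1).seq (t' := len d * (2 * lg V)) (R := (· = step (.seq c d) S)) ?_).mono
      ?_ fun _ => id
    · rintro _ rfl
      exact ihd h.2
    · rw [len, add_mul]
  | cond r c d ihc ihd =>
    have hr := lg_mono h.1
    by_cases h0 : S.reg r = 0
    · obtain ⟨S', τ, h1, h2, h3⟩ := ihd (by simpa [h0] using h.2)
      refine ⟨S', _, .cond_zero h0 h1, ?_, by simpa [step, h0] using h3⟩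
      rw [len, add_mul, add_mul]; omega
    · obtain ⟨S', τ, h1, h2, h3⟩ := ihc (by simpa [h0] using h.2)
      refine ⟨S', _, .cond_nonzero h0 h1, ?_, by simpa [step, h0] using h3⟩
      rw [len, add_mul, add_mul]; omega
  | loop r c => exact h.elim

theorem output_eq {S : Config} {l : List ℕ} (h0 : S.mem 0 = l.length)
    (h : ∀ i (hi : i < l.length), S.mem (i + 1) = l[i]) : output S = l := by
  refine List.ext_getElem (by simp [output, h0]) fun i h1 h2 => ?_
  simpa [output] using h i h2

theorem init_mem_zero (l : List ℕ) : (init l).mem 0 = l.length := rfl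

theorem init_mem_succ {l : List ℕ} {i : ℕ} (hi : i < l.length) : (init l).mem (i + 1) = l[i] := by
  simp [init, hi]

theorem Runs.computes {c : Ram} {inp out : List ℕ} {t : ℕ} {Q : Config → Prop}
    (h : Runs c (init inp) t Q) (hQ : ∀ S, Q S → output S = out) : c.Computes inp out t := by
  obtain ⟨S, τ, h1, h2, h3⟩ := h
  exact ⟨S, τ, h1, hQ S h3, h2⟩

theorem Computes.mono {c : Ram} {inp out : List ℕ} {t t' : ℕ} (h : c.Computes inp out t)
    (ht : t ≤ t') : c.Computes inp out t' := by
  obtain ⟨S, τ, h1, h2, h3⟩ := h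
  exact ⟨S, τ, h1, h2, h3.trans ht⟩

/-! ### Computing a prime -/

/-- Replaces the candidate in register `2` for a proper divisor of the number in register `1` by the
next smaller one, and puts the remainder into register `3`. -/
def remainderStep : Ram :=
  .seq (.sub 2 2 4) <| .seq (.div 5 1 2) <| .seq (.mul 5 5 2) <| .sub 3 1 5

/-- Tests the next candidate for a prime. Register `0` counts the primes that have to be found,
register `1` holds the candidate, and the loop finds its largest proper divisor. -/
def primeStep : Ram :=
  .seq (.seq (.add 1 1 4) <| .seq (.const 5 0) <| .seq (.add 2 1 5) remainderStep) <|
  .seq (.loop 3 remainderStep) <|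
  -- The candidate is prime exactly when its largest proper divisor is 1, and only then is the
  -- counter decreased; the other branch has no purpose beyond filling the conditional.
  .seq (.sub 5 2 4) <| .cond 5 (.const 5 0) (.sub 0 0 4)

/-- Started with `i + 1` in register `0`, puts the prime number `primeAt i` into register `1`. -/
def primeProgram : Ram :=
  .seq (.seq (.const 4 1) (.const 1 1)) (.loop 0 primeStep)

/-- `S` differs from `S₀` only in the registers below `6`. -/
def Frame (S₀ S : Config) : Prop := S.mem = S₀.mem ∧ ∀ i, 6 ≤ i → S.reg i = S₀.reg i

theorem Frame.trans {S₀ S₁ S₂ : Config} (h : Frame S₀ S₁) (h' : Frame S₁ S₂) : Frame S₀ S₂ :=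
  ⟨h'.1.trans h.1, fun i hi => (h'.2 i hi).trans (h.2 i hi)⟩

/-- The state of the search for the largest proper divisor of `p`. -/
structure DivisorSearch (S₀ : Config) (p c : ℕ) (S : Config) : Prop where
  frame : Frame S₀ S
  reg_zero : S.reg 0 = c
  reg_one : S.reg 1 = p
  reg_four : S.reg 4 = 1
  pos : 1 ≤ S.reg 2
  lt : S.reg 2 < p
  reg_three : S.reg 3 = p % S.reg 2
  not_dvd : ∀ e, S.reg 2 < e → e < p → ¬ e ∣ p

theorem remainderStep_fits {V p : ℕ} {S : Config} (hp : p ≤ V) (h1 : S.reg 1 = p)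
    (h4 : S.reg 4 = 1) (h2 : S.reg 2 ≤ p) (h2' : 1 ≤ S.reg 2) : Fits V remainderStep S := by
  have hd : p / (S.reg 2 - 1) ≤ p := Nat.div_le_self _ _
  have hm : p / (S.reg 2 - 1) * (S.reg 2 - 1) ≤ p := Nat.div_mul_le_self _ _
  simp only [Fits, remainderStep, step, Config.setReg_reg, h1, h4]
  norm_num
  omega

theorem DivisorSearch.step {S₀ S : Config} {p c V : ℕ} (h : DivisorSearch S₀ p c S) (hp : p ≤ V)
    (h3 : S.reg 3 ≠ 0) : Runs remainderStep S (4 * (2 * lg V)) fun S' =>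
      DivisorSearch S₀ p c S' ∧ S'.reg 2 < S.reg 2 := by
  -- The descent stops at 1 at the latest, where the remainder is zero.
  have hne : S.reg 2 ≠ 1 := by
    intro h1
    rw [h.reg_three, h1, Nat.mod_one] at h3
    exact h3 rfl
  have h2 : 2 ≤ S.reg 2 := by have := h.pos; omega
  refine (remainderStep_fits hp h.reg_one h.reg_four h.lt.le h.pos).runs.mono le_rfl ?_
  rintro _ rfl
  have hlt := h.lt
  refine ⟨⟨⟨?_, fun i hi => ?_⟩, ?_, ?_, ?_, ?_, ?_, ?_, ?_⟩, ?_⟩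
  · simpa [remainderStep, Ram.step] using h.frame.1
  · have : i ≠ 2 ∧ i ≠ 3 ∧ i ≠ 5 := by omega
    simpa [remainderStep, Ram.step, this] using h.frame.2 i hi
  · simpa [remainderStep, Ram.step] using h.reg_zero
  · simpa [remainderStep, Ram.step] using h.reg_one
  · simpa [remainderStep, Ram.step] using h.reg_four
  · simp [remainderStep, Ram.step, h.reg_four]; omega
  · simp [remainderStep, Ram.step, h.reg_four]; omega
  · simp [remainderStep, Ram.step, h.reg_four, h.reg_one, Nat.mod_eq_sub_div_mul]
  · simp only [remainderStep, Ram.step, Config.setReg_reg, h.reg_four]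
    norm_num
    intro e he hep
    rcases eq_or_ne e (S.reg 2) with rfl | hne'
    · rw [Nat.dvd_iff_mod_eq_zero, ← h.reg_three]; exact h3
    · exact h.not_dvd e (by omega) hep
  · simp [remainderStep, Ram.step, h.reg_four]; omega

/-- The state of the search for the prime `primeAt i`. -/
structure PrimeSearch (S₀ : Config) (i : ℕ) (S : Config) : Prop where
  frame : Frame S₀ S
  reg_four : S.reg 4 = 1
  pos : 1 ≤ S.reg 1
  le : S.reg 1 ≤ primeAt i
  count : Nat.count Nat.Prime (S.reg 1 + 1) + S.reg 0 = i + 1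
  prime : S.reg 0 = 0 → (S.reg 1).Prime

/-- While primes remain to be found, at most i primes are at most the candidate, so the search
cannot pass the target. -/
theorem PrimeSearch.lt {S₀ S : Config} {i : ℕ} (h : PrimeSearch S₀ i S) (h0 : S.reg 0 ≠ 0) :
    S.reg 1 + 1 ≤ primeAt i := by
  have h1 : Nat.count Nat.Prime (S.reg 1 + 1) ≤ i := by have := h.count; omega
  exact (Nat.count_le_iff_le_nth Nat.infinite_setOfPred_prime).1 h1

theorem PrimeSearch.step {S₀ S : Config} {i V : ℕ} (h : PrimeSearch S₀ i S) (h0 : S.reg 0 ≠ 0)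
    (hV : primeAt i ≤ V) (hiV : i + 1 ≤ V) :
    Runs primeStep S ((9 * primeAt i + 23) * lg V) fun S' =>
      PrimeSearch S₀ i S' ∧ primeAt i - S'.reg 1 < primeAt i - S.reg 1 := by
  have hlt := h.lt h0
  have hpos := h.pos
  have hcount := h.count
  set p := S.reg 1 + 1 with hp
  have hpV : p ≤ V := hlt.trans hV
  have hinit : Runs (.seq (.add 1 1 4) <| .seq (.const 5 0) <| .seq (.add 2 1 5) remainderStep) S
      (7 * (2 * lg V)) (DivisorSearch S p (S.reg 0)) := by
    have h1 : p / (p - 1) * (p - 1) ≤ p := Nat.div_mul_le_self _ _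
    have h2 : p / (p - 1) ≤ p := Nat.div_le_self _ _
    have h3 : p - 1 = S.reg 1 := rfl
    refine (Fits.runs (V := V) ?_).mono le_rfl ?_
    · rw [h3, hp] at h1 h2
      simp [Fits, remainderStep, Ram.step, h.reg_four]
      omega
    · rintro _ rfl
      refine ⟨⟨?_, fun j hj => ?_⟩, ?_, ?_, ?_, ?_, ?_, ?_, ?_⟩
      · simp [remainderStep, Ram.step]
      · have : j ≠ 1 ∧ j ≠ 2 ∧ j ≠ 3 ∧ j ≠ 5 := by omega
        simp [remainderStep, Ram.step, this]
      · simp [remainderStep, Ram.step]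
      · simp [remainderStep, Ram.step, h.reg_four, hp]
      · simp [remainderStep, Ram.step, h.reg_four]
      · simp [remainderStep, Ram.step, h.reg_four]; omega
      · simp [remainderStep, Ram.step, h.reg_four]; omega
      · simp [remainderStep, Ram.step, h.reg_four, Nat.mod_eq_sub_div_mul, hp]
      · simp only [remainderStep, Ram.step, Config.setReg_reg, h.reg_four]
        norm_num
        omega
  have hloop : ∀ S₁, DivisorSearch S p (S.reg 0) S₁ → Runs (.loop 3 remainderStep) S₁
      (primeAt i * (9 * lg V) + lg V)
      fun S₂ => DivisorSearch S p (S.reg 0) S₂ ∧ S₂.reg 3 = 0 := by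
    intro S₁ h₁
    refine (Runs.loop (b := lg V) (fun S => S.reg 2) (fun S hS => lg_mono ?_)
      (fun S hS h3 => hS.step hpV h3) h₁).mono ?_ fun _ => id
    · rw [hS.reg_three]; exact (Nat.mod_le _ _).trans hpV
    · have h2 : S₁.reg 2 ≤ primeAt i := h₁.lt.le.trans hlt
      have h3 := Nat.mul_le_mul_right (9 * lg V) h2
      have h4 : lg V + 4 * (2 * lg V) = 9 * lg V := by ring
      rw [h4]; omega
  refine (hinit.seq fun S₁ h₁ => (hloop S₁ h₁).seq (t' := 4 * (2 * lg V)) fun S₂ h₂ =>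
    (Fits.runs (V := V) ?_).mono le_rfl ?_).mono ?_ fun _ => id
  · obtain ⟨h₂, -⟩ := h₂
    have := h₂.lt
    simp only [Fits, Ram.step, Config.setReg_reg, h₂.reg_four, h₂.reg_zero]
    norm_num
    omega
  · obtain ⟨h₂, h30⟩ := h₂
    rintro _ rfl
    have hdvd : S₂.reg 2 ∣ p := by
      rw [Nat.dvd_iff_mod_eq_zero, ← h₂.reg_three]; exact h30
    have hpos₂ := h₂.pos
    have hlt₂ := h₂.lt
    have hprime : p.Prime ↔ S₂.reg 2 - 1 = 0 := by
      constructor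
      · intro hpp
        rcases (Nat.dvd_prime hpp).1 hdvd with h | h <;> omega
      · intro h21
        rw [Nat.prime_def_lt]
        refine ⟨by omega, fun m hm hmd => ?_⟩
        by_contra hm1
        have : 0 < m := Nat.pos_of_dvd_of_pos hmd (by omega)
        exact h₂.not_dvd m (by omega) hm hmd
    have hcs : Nat.count Nat.Prime (p + 1) = Nat.count Nat.Prime p + if p.Prime then 1 else 0 :=
      Nat.count_succ _ _
    by_cases h21 : S₂.reg 2 - 1 = 0
    · rw [if_pos (hprime.2 h21)] at hcs
      have hstep : Ram.step (.seq (.sub 5 2 4) <| .cond 5 (.const 5 0) (.sub 0 0 4)) S₂ =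
          (S₂.setReg 5 0).setReg 0 (S.reg 0 - 1) := by
        simp [Ram.step, h₂.reg_four, h21, h₂.reg_zero]
      rw [hstep]
      refine ⟨⟨h.frame.trans (h₂.frame.trans ⟨rfl, fun j hj => ?_⟩), ?_, ?_, ?_, ?_, ?_⟩, ?_⟩
      · have : j ≠ 0 ∧ j ≠ 5 := by omega
        simp [this]
      · simp [h₂.reg_four]
      · simp [h₂.reg_one]; omega
      · simpa [h₂.reg_one] using hlt
      · simp [h₂.reg_one]; omega
      · simpa [h₂.reg_one] using fun _ => hprime.2 h21
      · simp [h₂.reg_one]; omega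
    · rw [if_neg (fun h => h21 (hprime.1 h))] at hcs
      have hstep : Ram.step (.seq (.sub 5 2 4) <| .cond 5 (.const 5 0) (.sub 0 0 4)) S₂ =
          (S₂.setReg 5 (S₂.reg 2 - 1)).setReg 5 0 := by
        simp [Ram.step, h₂.reg_four, h21]
      rw [hstep]
      refine ⟨⟨h.frame.trans (h₂.frame.trans ⟨rfl, fun j hj => ?_⟩), ?_, ?_, ?_, ?_, ?_⟩, ?_⟩
      · have : j ≠ 5 := by omega
        simp [this]
      · simp [h₂.reg_four]
      · simp [h₂.reg_one]; omega
      · simpa [h₂.reg_one] using hlt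
      · simp [h₂.reg_one, h₂.reg_zero]; omega
      · simpa [h₂.reg_zero] using fun h => absurd h h0
      · simp [h₂.reg_one]; omega
  · ring_nf; omega

theorem primeProgram_runs {S₀ : Config} {i V : ℕ} (h0 : S₀.reg 0 = i + 1) (hV : primeAt i ≤ V)
    (hiV : i + 1 ≤ V) : Runs primeProgram S₀ ((primeAt i * (9 * primeAt i + 24) + 5) * lg V)
      fun S => Frame S₀ S ∧ S.reg 1 = primeAt i := by
  have hinit : Runs (.seq (.const 4 1) (.const 1 1)) S₀ (2 * (2 * lg V)) (PrimeSearch S₀ i) := by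
    refine (Fits.runs (V := V) ?_).mono le_rfl ?_
    · simp only [Fits]; omega
    · rintro _ rfl
      refine ⟨⟨rfl, fun j hj => ?_⟩, ?_, ?_, ?_, ?_, ?_⟩
      · have : j ≠ 1 ∧ j ≠ 4 := by omega
        simp [Ram.step, this]
      · simp [Ram.step]
      · simp [Ram.step]
      · simpa [Ram.step] using (primeAt_prime i).one_le
      · have : Nat.count Nat.Prime 2 = 0 := by decide
        simp [Ram.step, h0, this]
      · simp [Ram.step, h0]
  have hloop : ∀ S₁, PrimeSearch S₀ i S₁ → Runs (.loop 0 primeStep) S₁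
      (primeAt i * (lg V + (9 * primeAt i + 23) * lg V) + lg V)
      fun S₂ => PrimeSearch S₀ i S₂ ∧ S₂.reg 0 = 0 := by
    intro S₁ h₁
    refine (Runs.loop (b := lg V) (fun S => primeAt i - S.reg 1) (fun S hS => lg_mono ?_)
      (fun S hS h => hS.step h hV hiV) h₁).mono ?_ fun _ => id
    · have := hS.count; omega
    · gcongr; exact Nat.sub_le _ _
  refine (hinit.seq hloop).mono (le_of_eq (by ring)) ?_
  · rintro S ⟨hS, hS0⟩
    refine ⟨hS.frame, ?_⟩
    have hp := hS.prime hS0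
    have hc := hS.count
    rw [Nat.count_succ, if_pos hp, hS0] at hc
    rw [← primeAt_count hp, show Nat.count Nat.Prime (S.reg 1) = i by omega]

/-! ### The programs of the honest parties -/

theorem init_mem_le {l : List ℕ} {V : ℕ} (hl : ∀ v ∈ l, v ≤ V) (hV : l.length ≤ V) (i : ℕ) :
    (init l).mem i ≤ V := by
  rcases i with _ | i
  · exact hV
  · rcases lt_or_ge i l.length with h | h
    · rw [init_mem_succ h]; exact hl _ (List.getElem_mem h)
    · simp [init, h]

/-- On the input `i, β, v`, computes `v % primeAt β`. -/
def replyProgram : Ram :=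
  .seq (.seq (.const 6 2) <| .seq (.load 0 6) <| .seq (.const 6 1) (.add 0 0 6)) <|
  .seq primeProgram <|
  .seq (.const 6 3) <| .seq (.load 7 6) <| .seq (.div 8 7 1) <| .seq (.mul 8 8 1) <|
  .seq (.sub 7 7 8) <| .seq (.const 6 0) <| .seq (.const 8 1) <| .seq (.store 6 8) (.store 8 7)

theorem replyProgram_computes {i β v V : ℕ} (hp : primeAt β ≤ V) (hβ : β + 1 ≤ V) (hv : v ≤ V)
    (h3 : 3 ≤ V) : replyProgram.Computes [i, β, v] [v % primeAt β]
      ((primeAt β * (9 * primeAt β + 24) + 31) * lg V) := by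
  set S₀ := init [i, β, v] with hS₀
  have m2 : S₀.mem 2 = β := rfl
  have m3 : S₀.mem 3 = v := rfl
  have h1 : Runs (.seq (.const 6 2) <| .seq (.load 0 6) <| .seq (.const 6 1) (.add 0 0 6)) S₀
      (4 * (2 * lg V)) fun S => S.reg 0 = β + 1 ∧ S.mem = S₀.mem := by
    refine (Fits.runs (V := V) ?_).mono le_rfl ?_
    · simp [Fits, step, m2]; omega
    · rintro _ rfl
      simp [step, m2]
  refine ((h1.seq fun S hS => (primeProgram_runs hS.1 hp hβ).seq (t' := 9 * (2 * lg V))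
    (R := fun S => output S = [v % primeAt β]) fun S' hS' =>
      (Fits.runs (V := V) ?_).mono le_rfl ?_).mono (le_of_eq (by ring)) fun _ => id).computes
    fun _ => id
  · obtain ⟨⟨hm, -⟩, hr1⟩ := hS'
    rw [hS.2] at hm
    have e1 : v / primeAt β ≤ v := Nat.div_le_self _ _
    have e2 : v / primeAt β * primeAt β ≤ v := Nat.div_mul_le_self _ _
    simp [Fits, step, hm, hr1, m3]
    omega
  · obtain ⟨⟨hm, -⟩, hr1⟩ := hS'
    rw [hS.2] at hm
    rintro _ rfl
    refine output_eq ?_ fun i hi => ?_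
    · simp [step]
    · obtain rfl : i = 0 := by simpa using hi
      simp [step, hm, hr1, m3, Nat.mod_eq_sub_div_mul]

/-- Replaces the number in the cell addressed by register `7` by its remainder modulo register `1`,
and moves on to the previous cell. -/
def storeStep : Ram :=
  .seq (.load 9 7) <| .seq (.div 10 9 1) <| .seq (.mul 10 10 1) <| .seq (.sub 9 9 10) <|
  .seq (.store 7 9) <| .seq (.sub 7 7 6) (.sub 8 8 6)

/-- On the input `ω, x₁, …, x_s`, computes `ω` and the remainders of the `x_i` modulo
`primeAt ω`. -/
def storeProgram : Ram :=
  .seq (.seq (.const 6 1) <| .seq (.load 0 6) (.add 0 0 6)) <|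
  .seq primeProgram <|
  .seq (.seq (.const 4 0) <| .seq (.load 7 4) (.sub 8 7 6)) <|
  .loop 8 storeStep

theorem storeProgram_computes {ω V : ℕ} {l : List ℕ} (hp : primeAt ω ≤ V) (hω : ω + 1 ≤ V)
    (hl : ∀ v ∈ l, v ≤ V) (hV : l.length + 1 ≤ V) :
    storeProgram.Computes (ω :: l) (ω :: l.map (· % primeAt ω))
      ((primeAt ω * (9 * primeAt ω + 24) + 15 * l.length + 18) * lg V) := by
  set S₀ := init (ω :: l) with hS₀
  have m0 : S₀.mem 0 = l.length + 1 := rfl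
  have m1 : S₀.mem 1 = ω := rfl
  have hM : ∀ i, S₀.mem i ≤ V := init_mem_le (by
    intro v hv
    rcases List.mem_cons.1 hv with rfl | hv
    · omega
    · exact hl v hv) hV
  have h1 : Runs (.seq (.const 6 1) <| .seq (.load 0 6) (.add 0 0 6)) S₀
      (3 * (2 * lg V)) fun S => S.reg 0 = ω + 1 ∧ S.mem = S₀.mem ∧ S.reg 6 = 1 := by
    refine (Fits.runs (V := V) ?_).mono le_rfl ?_
    · simp [Fits, step, m1]; omega
    · rintro _ rfl
      simp [step, m1]
  -- The cells are processed from the last one downwards; those beyond register `7` are already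
  -- reduced. At the end register `7` is 1, so the cell holding ω is untouched.
  let I : Config → Prop := fun S => S.reg 1 = primeAt ω ∧ S.reg 6 = 1 ∧
    S.reg 7 = S.reg 8 + 1 ∧ S.reg 8 ≤ l.length ∧
    ∀ j, S.mem j = if S.reg 7 < j ∧ j ≤ l.length + 1 then S₀.mem j % primeAt ω else S₀.mem j
  have hstep : ∀ S, I S → S.reg 8 ≠ 0 → Runs storeStep S (7 * (2 * lg V)) fun S' =>
      I S' ∧ S'.reg 8 < S.reg 8 := by
    rintro S ⟨r1, r6, r7, r8, hm⟩ h0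
    have hm7 : S.mem (S.reg 7) = S₀.mem (S.reg 7) := by rw [hm, if_neg (by omega)]
    have hv := hM (S.reg 7)
    have e1 : S₀.mem (S.reg 7) / primeAt ω ≤ S₀.mem (S.reg 7) := Nat.div_le_self _ _
    have e2 : S₀.mem (S.reg 7) / primeAt ω * primeAt ω ≤ S₀.mem (S.reg 7) :=
      Nat.div_mul_le_self _ _
    refine (Fits.runs (V := V) ?_).mono le_rfl ?_
    · simp [Fits, storeStep, step, hm7, r1, r6]; omega
    · rintro _ rfl
      refine ⟨⟨?_, ?_, ?_, ?_, fun j => ?_⟩, ?_⟩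
      · simp [storeStep, step, r1]
      · simp [storeStep, step, r6]
      · simp [storeStep, step, r6]; omega
      · simp [storeStep, step, r6]; omega
      · simp only [storeStep, step, Config.setReg_reg, Config.setReg_mem, Config.setMem_mem,
          Config.setMem_reg, hm7, r1, r6]
        norm_num
        by_cases hj : j = S.reg 7
        · subst hj
          rw [if_pos rfl, if_pos (by omega), Nat.mod_eq_sub_div_mul]
        · rw [if_neg hj, hm]
          congr 1
          exact propext ⟨fun h => ⟨by omega, h.2⟩, fun h => ⟨by omega, h.2⟩⟩
      · simp [storeStep, step, r6]; omega
  have hend : ∀ S, I S ∧ S.reg 8 = 0 → output S = ω :: l.map (· % primeAt ω) := by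
    rintro S ⟨⟨r1, r6, r7, r8, hm⟩, h0⟩
    refine output_eq ?_ fun i hi => ?_
    · rw [hm, if_neg (by omega), m0]; simp
    · rcases i with _ | i
      · rw [hm, if_neg (by omega)]; exact m1
      · have hi' : i < l.length := by simpa using hi
        have : S₀.mem (i + 1 + 1) = l[i] := init_mem_succ (l := ω :: l) (by simpa using hi')
        rw [hm, if_pos (by omega), this]
        simp
  have hloop : ∀ S, I S → Runs (.loop 8 storeStep) S (l.length * (15 * lg V) + lg V) fun S' =>
      I S' ∧ S'.reg 8 = 0 := by
    intro S hS
    refine (Runs.loop (b := lg V) (fun S => S.reg 8) (fun S hS => lg_mono ?_) hstep hS).mono ?_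
      fun _ => id
    · have := hS.2.2.2.1; omega
    · have h3 := Nat.mul_le_mul_right (15 * lg V) hS.2.2.2.1
      rw [show lg V + 7 * (2 * lg V) = 15 * lg V by ring]
      omega
  refine ((h1.seq fun S hS => (primeProgram_runs hS.1 hp hω).seq fun S' hS' =>
    Runs.seq (t := 3 * (2 * lg V)) (Q := I) ((Fits.runs (V := V) ?_).mono le_rfl ?_)
      hloop).mono (le_of_eq (by ring)) fun _ => id).computes hend
  · obtain ⟨⟨hm, hf⟩, hr1⟩ := hS'
    have h6 := hf 6 le_rfl
    rw [hS.2.1] at hm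
    rw [hS.2.2] at h6
    simp [Fits, step, hm, h6, m0]
    omega
  · obtain ⟨⟨hm, hf⟩, hr1⟩ := hS'
    have h6 := hf 6 le_rfl
    rw [hS.2.1] at hm
    rw [hS.2.2] at h6
    rintro _ rfl
    refine ⟨?_, ?_, ?_, ?_, fun j => ?_⟩
    · simp [step, hr1]
    · simp [step, h6]
    · simp [step, hm, h6, m0]
    · simp [step, hm, h6, m0]
    · simp only [step, Config.setReg_reg, Config.setReg_mem, hm]
      norm_num [m0]

/-- Writes register `7` into the cell addressed by register `8`, and moves on to the previous
cell. -/
def challengeStep : Ram := .seq (.store 8 7) (.sub 8 8 6)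

/-- On an input of length `s + 1` that begins with `β`, computes the list of `s` copies of `β`. -/
def challengeProgram : Ram :=
  -- Register `9` is never written; its initial value 0 is the address of the length.
  .seq (.seq (.const 6 1) <| .seq (.load 7 6) <| .seq (.load 8 9) <| .seq (.sub 8 8 6)
    (.store 9 8)) <|
  .loop 8 challengeStep

theorem challengeProgram_computes {β V : ℕ} {l : List ℕ} (hβ : β ≤ V) (hV : l.length + 1 ≤ V) :
    challengeProgram.Computes (β :: l) (List.replicate l.length β)
      ((5 * l.length + 11) * lg V) := by
  set S₀ := init (β :: l) with hS₀
  have m0 : S₀.mem 0 = l.length + 1 := rfl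
  have m1 : S₀.mem 1 = β := rfl
  have hr : ∀ j, S₀.reg j = 0 := fun _ => rfl
  let I : Config → Prop := fun S => S.reg 6 = 1 ∧ S.reg 7 = β ∧ S.reg 8 ≤ l.length ∧
    S.mem 0 = l.length ∧ ∀ j, S.reg 8 < j → j ≤ l.length → S.mem j = β
  have h1 : Runs (.seq (.const 6 1) <| .seq (.load 7 6) <| .seq (.load 8 9) <| .seq (.sub 8 8 6)
      (.store 9 8)) S₀ (5 * (2 * lg V)) I := by
    refine (Fits.runs (V := V) ?_).mono le_rfl ?_
    · simp [Fits, step, m0, m1, hr]; omega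
    · rintro _ rfl
      refine ⟨?_, ?_, ?_, ?_, fun j hj hj' => ?_⟩
      · simp [step]
      · simp [step, m1]
      · simp [step, m0, hr]
      · simp [step, m0, hr]
      · simp [step, m0, hr] at hj; omega
  have hstep : ∀ S, I S → S.reg 8 ≠ 0 → Runs challengeStep S (2 * (2 * lg V)) fun S' =>
      I S' ∧ S'.reg 8 < S.reg 8 := by
    rintro S ⟨r6, r7, r8, hm0, hm⟩ h0
    refine (Fits.runs (V := V) ?_).mono le_rfl ?_
    · simp [Fits, challengeStep, step, r6, r7]; omega
    · rintro _ rfl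
      refine ⟨⟨?_, ?_, ?_, ?_, fun j hj hj' => ?_⟩, ?_⟩
      · simp [challengeStep, step, r6]
      · simp [challengeStep, step, r7]
      · simp [challengeStep, step, r6]; omega
      · simp [challengeStep, step, h0.symm, hm0]
      · simp [challengeStep, step, r6] at hj
        simp only [challengeStep, step, Config.setReg_mem, Config.setMem_mem, r7]
        split_ifs with hj8
        · rfl
        · exact hm j (by omega) hj'
      · simp [challengeStep, step, r6]; omega
  have hend : ∀ S, I S ∧ S.reg 8 = 0 → output S = List.replicate l.length β := by
    rintro S ⟨⟨r6, r7, r8, hm0, hm⟩, h0⟩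
    refine output_eq (by simpa using hm0) fun i hi => ?_
    have hi' : i < l.length := by simpa using hi
    rw [List.getElem_replicate, hm _ (by omega) (by omega)]
  have hloop : ∀ S, I S → Runs (.loop 8 challengeStep) S (l.length * (5 * lg V) + lg V) fun S' =>
      I S' ∧ S'.reg 8 = 0 := by
    intro S hS
    refine (Runs.loop (b := lg V) (fun S => S.reg 8) (fun S hS => lg_mono ?_) hstep hS).mono ?_
      fun _ => id
    · have := hS.2.2.1; omega
    · have h3 := Nat.mul_le_mul_right (5 * lg V) hS.2.2.1
      rw [show lg V + 2 * (2 * lg V) = 5 * lg V by ring]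
      omega
  exact ((h1.seq hloop).mono (le_of_eq (by ring)) fun _ => id).computes hend

/-- Compares the numbers in two cells at a distance given by register `12`, writes `0` into register
`11` if they differ, and moves on to the previous cells. -/
def acceptStep : Ram :=
  .seq (.add 7 8 6) <| .seq (.load 13 7) <| .seq (.add 7 7 12) <| .seq (.load 14 7) <|
  -- With truncated subtraction the sum of both differences is the absolute difference, and
  -- subtracting it from the flag leaves 0 after any mismatch.
  .seq (.sub 15 13 14) <| .seq (.sub 16 14 13) <| .seq (.add 15 15 16) <|
  .seq (.sub 11 11 15) (.sub 8 8 6)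

/-- On an input consisting of a number and two lists of equal length, decides whether the lists
are equal. -/
def acceptProgram : Ram :=
  .seq (.seq (.const 6 1) <| .seq (.const 10 2) <| .seq (.load 8 9) <| .seq (.div 8 8 10) <|
    .seq (.add 12 8 9) (.const 11 1)) <|
  .seq (.loop 8 acceptStep) <|
  -- Cell 0 receives the output length 1, and cell 1 the flag.
  .seq (.store 9 6) (.store 6 11)

theorem acceptProgram_computes {β V : ℕ} {l l' : List ℕ} (hll' : l'.length = l.length)
    (hβ : β ≤ V) (hl : ∀ v ∈ l, v ≤ V) (hl' : ∀ v ∈ l', v ≤ V) (hV : 2 * l.length + 2 ≤ V) :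
    acceptProgram.Computes ((β :: l) ++ l') [if l' = l then 1 else 0]
      ((19 * l.length + 17) * lg V) := by
  set S₀ := init ((β :: l) ++ l') with hS₀
  have m0 : S₀.mem 0 = 2 * l.length + 1 := by
    rw [hS₀, init_mem_zero]; simp; omega
  have hM : ∀ i, S₀.mem i ≤ V := init_mem_le (by
    intro v hv
    rcases List.mem_append.1 hv with hv | hv
    · rcases List.mem_cons.1 hv with rfl | hv
      · exact hβ
      · exact hl v hv
    · exact hl' v hv) (by simp; omega)
  have hml : ∀ i (hi : i < l.length), S₀.mem (i + 2) = l[i] := fun i hi => by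
    rw [hS₀, init_mem_succ (by simp; omega)]
    simp [hi]
  have hml' : ∀ i (hi : i < l'.length), S₀.mem (i + 2 + l.length) = l'[i] := fun i hi => by
    rw [show i + 2 + l.length = (i + l.length + 1) + 1 by ring, hS₀,
      init_mem_succ (by simp; omega)]
    simp
  have hr : ∀ j, S₀.reg j = 0 := fun _ => rfl
  let I : Config → Prop := fun S => S.reg 6 = 1 ∧ S.reg 8 ≤ l.length ∧ S.reg 9 = 0 ∧
    S.reg 12 = l.length ∧ S.mem = S₀.mem ∧ S.reg 11 =
      if ∀ j, S.reg 8 ≤ j → j < l.length → S₀.mem (j + 2) = S₀.mem (j + 2 + l.length)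
        then 1 else 0
  have h1 : Runs (.seq (.const 6 1) <| .seq (.const 10 2) <| .seq (.load 8 9) <|
      .seq (.div 8 8 10) <| .seq (.add 12 8 9) (.const 11 1)) S₀ (6 * (2 * lg V)) I := by
    have hdiv : (2 * l.length + 1) / 2 = l.length := by omega
    refine (Fits.runs (V := V) ?_).mono le_rfl ?_
    · simp [Fits, step, m0, hr, hdiv]; omega
    · rintro _ rfl
      refine ⟨?_, ?_, ?_, ?_, ?_, ?_⟩
      · simp [step]
      · simp [step, m0, hr, hdiv]
      · simp [step, hr]
      · simp [step, m0, hr, hdiv]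
      · simp [step]
      · rw [if_pos]
        · simp [step]
        · intro j hj hj'
          simp [step, m0, hr, hdiv] at hj
          omega
  have hstep : ∀ S, I S → S.reg 8 ≠ 0 → Runs acceptStep S (9 * (2 * lg V)) fun S' =>
      I S' ∧ S'.reg 8 < S.reg 8 := by
    rintro S ⟨r6, r8, r9, r12, hm, r11⟩ h0
    obtain ⟨m, hm8⟩ : ∃ m, S.reg 8 = m + 1 := ⟨S.reg 8 - 1, by omega⟩
    rw [hm8] at r8 r11
    have b1 := hM (m + 1 + 1)
    have b2 := hM (m + 1 + 1 + l.length)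
    refine (Fits.runs (V := V) ?_).mono le_rfl ?_
    · have b3 : S.reg 11 ≤ 1 := by rw [r11]; split_ifs <;> omega
      simp [Fits, acceptStep, step, r6, r12, hm, hm8]
      omega
    · rintro _ rfl
      refine ⟨⟨?_, ?_, ?_, ?_, ?_, ?_⟩, ?_⟩
      · simp [acceptStep, step, r6]
      · simp [acceptStep, step, r6, hm8]; omega
      · simp [acceptStep, step, r9]
      · simp [acceptStep, step, r12]
      · simp [acceptStep, step, hm]
      · have hiff : (∀ j, m ≤ j → j < l.length → S₀.mem (j + 2) = S₀.mem (j + 2 + l.length)) ↔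
            (∀ j, m + 1 ≤ j → j < l.length → S₀.mem (j + 2) = S₀.mem (j + 2 + l.length)) ∧
              S₀.mem (m + 1 + 1) = S₀.mem (m + 1 + 1 + l.length) := by
          refine ⟨fun h => ⟨fun j hj => h j (by omega), h m le_rfl (by omega)⟩, ?_⟩
          rintro ⟨h, h'⟩ j hj hj'
          rcases eq_or_ne j m with rfl | hne
          · exact h'
          · exact h j (by omega) hj'
        simp only [acceptStep, step, Config.setReg_reg, Config.setReg_mem, r6, r12, hm, hm8, r11]
        simp only [Nat.reduceEqDiff, if_true, if_false, Nat.add_sub_cancel, hiff]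
        by_cases hP : ∀ j, m + 1 ≤ j → j < l.length → S₀.mem (j + 2) = S₀.mem (j + 2 + l.length)
        · by_cases hQ : S₀.mem (m + 1 + 1) = S₀.mem (m + 1 + 1 + l.length)
          · rw [if_pos hP, if_pos ⟨hP, hQ⟩]; omega
          · rw [if_pos hP, if_neg fun h => hQ h.2]; omega
        · rw [if_neg hP, if_neg fun h => hP h.1]; omega
      · simp [acceptStep, step, r6, hm8]
  have hend : ∀ S, I S ∧ S.reg 8 = 0 → Runs (.seq (.store 9 6) (.store 6 11)) S (2 * (2 * lg V))
      fun S => output S = [if l' = l then 1 else 0] := by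
    rintro S ⟨⟨r6, r8, r9, r12, hm, r11⟩, h0⟩
    have hiff : (∀ j, S.reg 8 ≤ j → j < l.length →
        S₀.mem (j + 2) = S₀.mem (j + 2 + l.length)) ↔ l' = l := by
      constructor
      · intro h
        refine List.ext_getElem hll' fun j h1 h2 => ?_
        rw [← hml j h2, ← hml' j h1, h j (by omega) h2]
      · rintro rfl j _ hj
        rw [hml j hj, hml' j hj]
    simp only [hiff] at r11
    have h11 : S.reg 11 ≤ 1 := by rw [r11]; split_ifs <;> omega
    refine (Fits.runs (V := V) ?_).mono le_rfl ?_
    · simp [Fits, step, r6, r9]; omega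
    · rintro _ rfl
      refine output_eq ?_ fun i hi => ?_
      · simp [step, r6, r9]
      · obtain rfl : i = 0 := by simpa using hi
        simp [step, r6, r11]
  have hloop : ∀ S, I S → Runs (.loop 8 acceptStep) S (l.length * (19 * lg V) + lg V) fun S' =>
      I S' ∧ S'.reg 8 = 0 := by
    intro S hS
    refine (Runs.loop (b := lg V) (fun S => S.reg 8) (fun S hS => lg_mono ?_) hstep hS).mono ?_
      fun _ => id
    · have := hS.2.1; omega
    · have h3 := Nat.mul_le_mul_right (19 * lg V) hS.2.1
      rw [show lg V + 9 * (2 * lg V) = 19 * lg V by ring]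
      omega
  exact ((h1.seq fun S hS => (hloop S hS).seq hend).mono (le_of_eq (by ring))
    fun _ => id).computes fun _ => id

end Ram

/-! ### Efficiency -/

/-- The programs of the honest parties in the protocol based on the CRT code. -/
def crtPrograms : Protocol.HonestPrograms where
  store := Ram.storeProgram
  challenge := Ram.challengeProgram
  accept := Ram.acceptProgram
  reply := Ram.replyProgram

/-- A bound for the running time of the honest parties. -/
noncomputable def crtTime : Polynomial ℕ :=
  (36 * Polynomial.X ^ 4 + 48 * Polynomial.X ^ 2 + 19 * Polynomial.X + 49) *
    (6 * Polynomial.X ^ 2 + 5)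

theorem crtTime_eval (m : ℕ) :
    crtTime.eval m = (36 * m ^ 4 + 48 * m ^ 2 + 19 * m + 49) * (6 * m ^ 2 + 5) := by
  simp [crtTime]

theorem lg_crtSize_mul_le {k m : ℕ} (hk : 1 ≤ k) (hkm : k ≤ m) :
    Ram.lg (crtSize k * (2 * m ^ 2 + 4)) ≤ 6 * m ^ 2 + 5 := by
  have h1 := Nat.size_mul_le (crtSize k) (2 * m ^ 2 + 4)
  have h2 := size_crtSize_le hk
  have h3 : Nat.size (2 * m ^ 2 + 4) ≤ 2 * m ^ 2 + 4 := Nat.size_le.2 Nat.lt_two_pow_self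
  have h4 : k ^ 2 ≤ m ^ 2 := Nat.pow_le_pow_left hkm 2
  rw [Ram.lg]
  omega

theorem primeAt_le_of_lt {β m : ℕ} (h : β < m) : primeAt β ≤ 2 * m ^ 2 :=
  (primeAt_le_sq β).trans (Nat.mul_le_mul_left _ (Nat.pow_le_pow_left h 2))

/-- All four tasks have a running time of this shape, with q the prime that is computed, or 0 if
none is. The product inside `lg` bounds both the data and the small numbers, and its binary length
is at most the sum of those of its factors. -/
theorem mul_lg_le_crtTime {k m q t : ℕ} (hk : 1 ≤ k) (hkm : k ≤ m) (hq : q ≤ 2 * m ^ 2)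
    (ht : t ≤ q * (9 * q + 24) + 19 * m + 49) :
    t * Ram.lg (crtSize k * (2 * m ^ 2 + 4)) ≤ crtTime.eval m := by
  rw [crtTime_eval]
  refine Nat.mul_le_mul (ht.trans ?_) (lg_crtSize_mul_le hk hkm)
  calc q * (9 * q + 24) + 19 * m + 49 ≤
        2 * m ^ 2 * (9 * (2 * m ^ 2) + 24) + 19 * m + 49 := by gcongr
    _ = _ := by ring

theorem crtProtocol_runsWithin {k n s : ℕ} (hk : 1 ≤ k) (hkn : k ≤ n) :
    (crtProtocol k n s).RunsWithin crtPrograms (crtTime.eval (n + s)) (crtTime.eval n) := by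
  have hN := crtSize_pos k
  have hmul : ∀ m v : ℕ, v ≤ 2 * m ^ 2 + 4 → v ≤ crtSize k * (2 * m ^ 2 + 4) := fun m v hv =>
    hv.trans (Nat.le_mul_of_pos_left _ hN)
  have hmul' : ∀ m v : ℕ, v < crtSize k → v ≤ crtSize k * (2 * m ^ 2 + 4) := fun m v hv =>
    hv.le.trans (Nat.le_mul_of_pos_right _ (by omega))
  have hsq : ∀ m : ℕ, m ≤ m ^ 2 := fun m => Nat.le_self_pow two_ne_zero m
  have hns := hsq (n + s)
  have hsymb : ∀ (β : Fin n) (v : Fin (primeAt (n - 1))),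
      (v : ℕ) ≤ 2 * (n + s) ^ 2 + 4 := fun β v => by
    have hβ := β.isLt
    have h1 : primeAt (n - 1) ≤ 2 * (n + s) ^ 2 := primeAt_le_of_lt (by omega)
    have := v.isLt
    omega
  refine ⟨fun ω x => ?_, fun σ => ?_, fun σ z => ?_, fun i β v => ?_⟩
  · have hω : (ω : ℕ) < n := ω.isLt
    have hq : primeAt ω ≤ 2 * (n + s) ^ 2 := primeAt_le_of_lt (by omega)
    have h := Ram.storeProgram_computes (ω := ω) (V := crtSize k * (2 * (n + s) ^ 2 + 4))
      (l := List.ofFn fun i => (x i : ℕ)) (hmul _ _ (by omega)) (hmul _ _ (by omega))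
      (fun v hv => by
        obtain ⟨i, rfl⟩ := List.mem_ofFn.1 hv
        exact hmul' _ _ (x i).isLt) (hmul _ _ (by rw [List.length_ofFn]; omega))
    rw [List.map_ofFn, List.length_ofFn] at h
    exact h.mono (mul_lg_le_crtTime hk (by omega) hq (by omega))
  · obtain ⟨β, w⟩ := σ
    have hβ : (β : ℕ) < n := β.isLt
    have h := Ram.challengeProgram_computes (β := β) (V := crtSize k * (2 * (n + s) ^ 2 + 4))
      (l := List.ofFn fun i => (w i : ℕ)) (hmul _ _ (by omega))
      (hmul _ _ (by rw [List.length_ofFn]; omega))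
    rw [List.length_ofFn, ← List.ofFn_const] at h
    exact h.mono (mul_lg_le_crtTime (q := 0) hk (by omega) (by omega) (by omega))
  · obtain ⟨β, w⟩ := σ
    have hβ : (β : ℕ) < n := β.isLt
    have h := Ram.acceptProgram_computes (β := β) (V := crtSize k * (2 * (n + s) ^ 2 + 4))
      (l := List.ofFn fun i => (w i : ℕ)) (l' := List.ofFn fun i => (z i : ℕ)) (by simp)
      (hmul _ _ (by omega)) (fun v hv => by
        obtain ⟨i, rfl⟩ := List.mem_ofFn.1 hv
        exact hmul _ _ (hsymb β _)) (fun v hv => by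
        obtain ⟨i, rfl⟩ := List.mem_ofFn.1 hv
        exact hmul _ _ (hsymb β _)) (hmul _ _ (by rw [List.length_ofFn]; nlinarith))
    have hiff : (List.ofFn fun i => (z i : ℕ)) = (List.ofFn fun i => (w i : ℕ)) ↔
        (crtProtocol k n s).accept (β, w) z = true := by
      rw [List.ofFn_inj]
      simp only [crtProtocol, decide_eq_true_eq]
      exact ⟨fun h => funext fun i => Fin.ext (congrFun h i), fun h => by rw [h]⟩
    simp only [hiff, List.length_ofFn] at h
    exact h.mono (mul_lg_le_crtTime (q := 0) hk (by omega) (by omega) (by omega))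
  · have hβ : (β : ℕ) < n := β.isLt
    have hq := primeAt_le_of_lt hβ
    have hn := hsq n
    exact (Ram.replyProgram_computes (i := i) (β := β) (v := v)
      (V := crtSize k * (2 * n ^ 2 + 4)) (hmul _ _ (by omega)) (hmul _ _ (by omega))
      (hmul' _ _ v.isLt) (hmul _ _ (by omega))).mono
      (mul_lg_le_crtTime hk hkn hq (by omega))

theorem mainTheorem9 :
    (∀ U : List Bool →. List Bool, IsOptimalMachine U →
      ∀ (a : ℕ) (B : ℝ), 4 < B →
      ∃ c₀ c₁ c₂ : ℕ, 0 < c₀ ∧ 0 < c₁ ∧ 0 < c₂ ∧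
        ∀ (k s : ℕ) (ε : ℝ), 1 ≤ k → 1 ≤ s → 0 < ε → ε ≤ 1 → B ≤ k / ε →
          (crtProtocol k ⌊(k : ℝ) / ε ^ 2⌋₊ s).IsVerificationProtocol s
            ((s + 1) * Real.logb 2 k + s - (s + 1) * Real.logb 2 (ε ^ 2)
              + s * Real.logb 2 (Real.logb 2 (k / ε ^ 2)))
            (2 * s * Real.logb 2 k - 2 * s * Real.logb 2 (ε ^ 2) + s
              + s * Real.logb 2 (Real.logb 2 (k / ε ^ 2)))
            a ε
            (fun z => plainComplexity U z
              - c₀ * (s * (Real.logb 2 (k / ε) - Real.logb 2 (Real.logb 2 (k / ε)) - 1))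
              - c₁ * Real.logb 2 (Real.logb 2 (Real.logb 2 (k / ε)))
              - c₂) ∧
          (crtProtocol k ⌊(k : ℝ) / ε ^ 2⌋₊ s).replyBits ≤
            s * Real.logb 2 k - s * Real.logb 2 (ε ^ 2) + s
              + s * Real.logb 2 (Real.logb 2 (k / ε ^ 2))) ∧
    (∃ (h : Protocol.HonestPrograms) (p : Polynomial ℕ),
      ∀ (k s : ℕ) (ε : ℝ), 1 ≤ k → 1 ≤ s → 0 < ε → ε ≤ 1 →
        (crtProtocol k ⌊(k : ℝ) / ε ^ 2⌋₊ s).RunsWithin h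
          (p.eval (⌊(k : ℝ) / ε ^ 2⌋₊ + s)) (p.eval ⌊(k : ℝ) / ε ^ 2⌋₊)) := by
  refine ⟨fun U hU a B hB => crtProtocol_isVerificationProtocol hU a hB, crtPrograms, crtTime, ?_⟩
  intro k s ε hk _ hε hε1
  exact crtProtocol_runsWithin hk (le_floor_div_sq hε hε1)
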